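/- Let $A$ be an artin algebra, that is, an algebra over a commutative artinian ring $R$ which is finitely generated as an $R$-module. Modules are left $A$-modules, not necessarily finitely generated, and $\mathrm{Hom}=\mathrm{Hom}_A$. A module is Gorenstein-projective if it is isomorphic to the zeroth cocycle $Z^0(P^\bullet)$ of an acyclic complex $P^\bullet$ (indexed by $\mathbb{Z}$) of projective modules such that $\mathrm{Hom}(P^\bullet,Q)$ is acyclic for every projective module $Q$. Dually, a module is Gorenstein-injective if it is isomorphic to the zeroth coboundary $B^0(I^\bullet)$ of an acyclic complex $I^\bullet$ of injective modules such that $\mathrm{Hom}(J,I^\bullet)$ is acyclic for every injective module $J$. A proper Gorenstein-projective resolution of a module $M$ is an acyclic complex $\cdots\to G^{-1}\to G^{0}\to M\to 0$ with all $G^{-i}$ Gorenstein-projective which stays acyclic under $\mathrm{Hom}(G,-)$ for every Gorenstein-projective module $G$. Dually, a proper Gorenstein-injective coresolution of a module $N$ is an acyclic complex $0\to N\to R^0\to R^1\to\cdots$ with all $R^i$ Gorenstein-injective which stays acyclic under $\mathrm{Hom}(-,R)$ for every Gorenstein-injective module $R$. Both are unique up to homotopy equivalence, and morphisms of modules lift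 to them uniquely up to homotopy. For $n\ge 0$ put $$\mathrm{Ext}^n_{\mathrm{GP}}(M,N)=H^n(\mathrm{Hom}(G_M^\bullet,N)),\qquad \mathrm{Ext}^n_{\mathrm{GI}}(M,N)=H^n(\mathrm{Hom}(M,R_N^\bullet)),$$ where $G_M^\bullet\to M$ is a proper Gorenstein-projective resolution and $N\to R_N^\bullet$ is a proper Gorenstein-injective coresolution; these groups are functorial in $M$ and $N$. A module $M$ has finite Gorenstein-projective dimension if it has a proper Gorenstein-projective resolution and $\mathrm{GP.dim}\,M=\sup\{n\ge 0\mid \mathrm{Ext}^n_{\mathrm{GP}}(M,-)\ne 0\}$ is finite; a module $N$ has finite Gorenstein-injective dimension if it has a proper Gorenstein-injective coresolution and $\mathrm{GI.dim}\,N=\sup\{n\ge 0\mid \mathrm{Ext}^n_{\mathrm{GI}}(-,N)\ne 0\}$ is finite. (Over an artin algebra such a resolution and such a coresolution in fact exist for every module.) Theorem (Holm). For each $n\ge 0$ there are isomorphisms of abelian groups $$\mathrm{Ext}^n_{\mathrm{GP}}(M,N)\;\cong\;\mathrm{Ext}^n_{\mathrm{GI}}(M,N)$$ for all modules $M$ of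 finite Gorenstein-projective dimension and all modules $N$ of finite Gorenstein-injective dimension, and these isomorphisms are natural in both $M$ and $N$. -/

import Mathlib

open CategoryTheory Limits Opposite

universe u v w

namespace GorensteinHom

noncomputable section

section HomComplexes

variable {C : Type u} [Category.{v} C] [Preadditive C] {ι : Type w} (c : ComplexShape ι)

/-- The covariant Hom complex `Hom(M, K)` of abelian groups, as a functor in `M` and `K`: in degree
`i` it is the group of morphisms `M ⟶ K.X i`, with the differential given by composition. -/
def homFrom : Cᵒᵖ ⥤ HomologicalComplex C c ⥤ HomologicalComplex AddCommGrpCat.{v} c where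
  obj M := (preadditiveCoyoneda.obj M).mapHomologicalComplex c
  map f := NatTrans.mapHomologicalComplex (preadditiveCoyoneda.map f) c

/-- The contravariant Hom complex `Hom(K, N)` of abelian groups, as a functor in `K` and `N`: in
degree `i` it is the group of morphisms `K.X i ⟶ N`, with the differential given by composition;
the differentials go in the opposite direction, hence the reversed complex shape `c.symm`. -/
def homTo : (HomologicalComplex C c)ᵒᵖ ⥤ C ⥤ HomologicalComplex AddCommGrpCat.{v} c.symm where
  obj K :=
    { obj := fun N => ((preadditiveYoneda.obj N).mapHomologicalComplex c.symm).obj K.unop.op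
      map := fun g =>
        (NatTrans.mapHomologicalComplex (preadditiveYoneda.map g) c.symm).app K.unop.op
      map_id := fun N => by
        simp only [CategoryTheory.Functor.map_id, NatTrans.mapHomologicalComplex_id]; rfl
      map_comp := fun f g => by
        simp only [Functor.map_comp, NatTrans.mapHomologicalComplex_comp]; rfl }
  map f :=
    { app := fun N => ((preadditiveYoneda.obj N).mapHomologicalComplex c.symm).map
        ((HomologicalComplex.opFunctor C c).map f)
      naturality := fun _ _ g =>
        ((NatTrans.mapHomologicalComplex (preadditiveYoneda.map g) c.symm).naturality _).symm }
  map_id K := by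
    ext N : 2
    exact (((preadditiveYoneda.obj N).mapHomologicalComplex c.symm).congr_map
      ((HomologicalComplex.opFunctor C c).map_id K)).trans (CategoryTheory.Functor.map_id _ _)
  map_comp f g := by
    ext N : 2
    exact (((preadditiveYoneda.obj N).mapHomologicalComplex c.symm).congr_map
      ((HomologicalComplex.opFunctor C c).map_comp f g)).trans (Functor.map_comp _ _ _)

variable {c}

theorem exists_lift_of_acyclic {G : C} {K : HomologicalComplex C c}
    (h : (((homFrom c).obj (op G)).obj K).Acyclic) {i j k : ι} (hi : c.prev j = i)
    (hk : c.next j = k) (a : G ⟶ K.X j) (ha : a ≫ K.d j k = 0) :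
    ∃ b : G ⟶ K.X i, b ≫ K.d i j = a := by
  have h' := (HomologicalComplex.exactAt_iff' _ i j k hi hk).1 (h j)
  rw [ShortComplex.ab_exact_iff] at h'
  exact h' a ha

theorem exists_ext_of_acyclic {G : C} {K : HomologicalComplex C c}
    (h : (((homTo c).obj (op K)).obj G).Acyclic) {i j k : ι} (hi : c.prev j = i)
    (hk : c.next j = k) (a : K.X j ⟶ G) (ha : K.d i j ≫ a = 0) :
    ∃ b : K.X k ⟶ G, K.d j k ≫ b = a := by
  have h' := (HomologicalComplex.exactAt_iff' _ k j i
    (show c.symm.prev j = k from hk) (show c.symm.next j = i from hi)).1 (h j)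
  rw [ShortComplex.ab_exact_iff] at h'
  exact h' a ha

theorem homologyMap_homTo_eq {K L : HomologicalComplex C c} {f g : K ⟶ L} (h : Homotopy f g)
    (N : C) (n : ι) :
    HomologicalComplex.homologyMap (((homTo c).map f.op).app N) n =
      HomologicalComplex.homologyMap (((homTo c).map g.op).app N) n :=
  ((preadditiveYoneda.obj N).mapHomotopy h.op).homologyMap_eq n

theorem homologyMap_homFrom_eq {K L : HomologicalComplex C c} {f g : K ⟶ L} (h : Homotopy f g)
    (M : Cᵒᵖ) (n : ι) :
    HomologicalComplex.homologyMap (((homFrom c).obj M).map f) n =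
      HomologicalComplex.homologyMap (((homFrom c).obj M).map g) n :=
  ((preadditiveCoyoneda.obj M).mapHomotopy h).homologyMap_eq n

end HomComplexes

section Relative

variable {C : Type u} [Category.{v} C] [Abelian C] (X : ObjectProperty C)

/-- A proper left resolution `⋯ ⟶ G₁ ⟶ G₀ ⟶ M ⟶ 0` of `M` by objects of `X`: the augmented complex
is acyclic, and it stays acyclic under `Hom(G, -)` for every `G` in `X`. -/
structure ProperResolution (M : C) where
  /-- the complex `⋯ ⟶ G₁ ⟶ G₀` -/
  complex : ChainComplex C ℕ
  /-- the augmentation `G₀ ⟶ M` -/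
  π : complex.X 0 ⟶ M
  d_π : complex.d 1 0 ≫ π = 0
  mem : ∀ i, X (complex.X i)
  acyclic : (complex.augment π d_π).Acyclic
  proper : ∀ G : C, X G → (((homFrom _).obj (op G)).obj (complex.augment π d_π)).Acyclic

/-- A proper right coresolution `0 ⟶ N ⟶ R⁰ ⟶ R¹ ⟶ ⋯` of `N` by objects of `X`: the augmented
complex is acyclic, and it stays acyclic under `Hom(-, G)` for every `G` in `X`. -/
structure ProperCoresolution (N : C) where
  /-- the complex `R⁰ ⟶ R¹ ⟶ ⋯` -/
  complex : CochainComplex C ℕ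
  /-- the coaugmentation `N ⟶ R⁰` -/
  η : N ⟶ complex.X 0
  η_d : η ≫ complex.d 0 1 = 0
  mem : ∀ i, X (complex.X i)
  acyclic : (complex.augment η η_d).Acyclic
  proper : ∀ G : C, X G → (((homTo _).obj (op (complex.augment η η_d))).obj G).Acyclic

variable {X}

namespace ProperResolution

variable {M M' M'' : C}

theorem lift_zero (P : ProperResolution X M) {G : C} (hG : X G) (a : G ⟶ M) :
    ∃ b : G ⟶ P.complex.X 0, b ≫ P.π = a :=
  exists_lift_of_acyclic (P.proper G hG) (i := 1) (j := 0) (k := 0) (by simp) (by simp) a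
    ((congrArg (a ≫ ·) ((P.complex.augment P.π P.d_π).shape 0 0 (by simp))).trans comp_zero)

theorem lift_one (P : ProperResolution X M) {G : C} (hG : X G) (a : G ⟶ P.complex.X 0)
    (ha : a ≫ P.π = 0) : ∃ b : G ⟶ P.complex.X 1, b ≫ P.complex.d 1 0 = a :=
  exists_lift_of_acyclic (P.proper G hG) (i := 2) (j := 1) (k := 0) (by simp) (by simp) a ha

theorem lift_succ (P : ProperResolution X M) {G : C} (hG : X G) (n : ℕ)
    (a : G ⟶ P.complex.X (n + 1)) (ha : a ≫ P.complex.d (n + 1) n = 0) :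
    ∃ b : G ⟶ P.complex.X (n + 2), b ≫ P.complex.d (n + 2) (n + 1) = a :=
  exists_lift_of_acyclic (P.proper G hG) (i := n + 3) (j := n + 2) (k := n + 1)
    (by simp) (by simp) a ha

theorem exists_chainMap (P : ProperResolution X M) (Q : ProperResolution X M') (f : M ⟶ M') :
    ∃ φ : P.complex ⟶ Q.complex, φ.f 0 ≫ Q.π = P.π ≫ f := by
  obtain ⟨z, hz⟩ := Q.lift_zero (P.mem 0) (P.π ≫ f)
  obtain ⟨o, ho⟩ := Q.lift_one (P.mem 1) (P.complex.d 1 0 ≫ z) (by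
    rw [Category.assoc, hz, ← Category.assoc, P.d_π, zero_comp])
  have hs : ∀ (n : ℕ) (g : P.complex.X n ⟶ Q.complex.X n)
      (g' : P.complex.X (n + 1) ⟶ Q.complex.X (n + 1))
      (_ : g' ≫ Q.complex.d (n + 1) n = P.complex.d (n + 1) n ≫ g),
      ∃ g'' : P.complex.X (n + 2) ⟶ Q.complex.X (n + 2),
        g'' ≫ Q.complex.d (n + 2) (n + 1) = P.complex.d (n + 2) (n + 1) ≫ g' :=
    fun n g g' w => Q.lift_succ (P.mem _) n _ (by
      rw [Category.assoc, w, ← Category.assoc, HomologicalComplex.d_comp_d, zero_comp])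
  exact ⟨ChainComplex.mkHom _ _ z o ho fun n p =>
    ⟨(hs n p.1 p.2.1 p.2.2).choose, (hs n p.1 p.2.1 p.2.2).choose_spec⟩, hz⟩

theorem nonempty_homotopy_zero (P : ProperResolution X M) (Q : ProperResolution X M')
    (φ : P.complex ⟶ Q.complex) (h : φ.f 0 ≫ Q.π = 0) : Nonempty (Homotopy φ 0) := by
  obtain ⟨z, hz⟩ := Q.lift_one (P.mem 0) (φ.f 0) h
  obtain ⟨o, ho⟩ := Q.lift_succ (P.mem 1) 0 (φ.f 1 - P.complex.d 1 0 ≫ z) (by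
    rw [Preadditive.sub_comp, Category.assoc, hz, φ.comm, sub_self])
  have hs : ∀ (n : ℕ) (g : P.complex.X n ⟶ Q.complex.X (n + 1))
      (g' : P.complex.X (n + 1) ⟶ Q.complex.X (n + 2))
      (_ : φ.f (n + 1) = P.complex.d (n + 1) n ≫ g + g' ≫ Q.complex.d (n + 2) (n + 1)),
      ∃ g'' : P.complex.X (n + 2) ⟶ Q.complex.X (n + 3),
        φ.f (n + 2) = P.complex.d (n + 2) (n + 1) ≫ g' + g'' ≫ Q.complex.d (n + 3) (n + 2) := by
    intro n g g' w
    obtain ⟨b, hb⟩ := Q.lift_succ (P.mem _) (n + 1)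
      (φ.f (n + 2) - P.complex.d (n + 2) (n + 1) ≫ g') (by simp [w])
    exact ⟨b, by rw [hb]; abel⟩
  exact ⟨Homotopy.mkInductive _ z hz.symm o (by rw [ho]; abel) fun n p =>
    ⟨(hs n p.1 p.2.1 p.2.2).choose, (hs n p.1 p.2.1 p.2.2).choose_spec⟩⟩

theorem nonempty_homotopy (P : ProperResolution X M) (Q : ProperResolution X M')
    (φ ψ : P.complex ⟶ Q.complex) (h : φ.f 0 ≫ Q.π = ψ.f 0 ≫ Q.π) : Nonempty (Homotopy φ ψ) :=
  (nonempty_homotopy_zero P Q (φ - ψ) (by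
    rw [HomologicalComplex.sub_f_apply, Preadditive.sub_comp, h, sub_self])).map
      Homotopy.equivSubZero.invFun

/-- A chosen chain map of proper resolutions over a morphism; it is unique up to homotopy. -/
def lift (P : ProperResolution X M) (Q : ProperResolution X M') (f : M ⟶ M') :
    P.complex ⟶ Q.complex :=
  (exists_chainMap P Q f).choose

theorem lift_π (P : ProperResolution X M) (Q : ProperResolution X M') (f : M ⟶ M') :
    (lift P Q f).f 0 ≫ Q.π = P.π ≫ f :=
  (exists_chainMap P Q f).choose_spec

end ProperResolution

namespace ProperCoresolution

variable {N N' N'' : C}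

theorem ext_zero (P : ProperCoresolution X N) {G : C} (hG : X G) (a : N ⟶ G) :
    ∃ b : P.complex.X 0 ⟶ G, P.η ≫ b = a :=
  exists_ext_of_acyclic (P.proper G hG) (i := 0) (j := 0) (k := 1) (by simp) (by simp) a
    ((congrArg (· ≫ a) ((P.complex.augment P.η P.η_d).shape 0 0 (by simp))).trans zero_comp)

theorem ext_one (P : ProperCoresolution X N) {G : C} (hG : X G) (a : P.complex.X 0 ⟶ G)
    (ha : P.η ≫ a = 0) : ∃ b : P.complex.X 1 ⟶ G, P.complex.d 0 1 ≫ b = a :=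
  exists_ext_of_acyclic (P.proper G hG) (i := 0) (j := 1) (k := 2) (by simp) (by simp) a ha

theorem ext_succ (P : ProperCoresolution X N) {G : C} (hG : X G) (n : ℕ)
    (a : P.complex.X (n + 1) ⟶ G) (ha : P.complex.d n (n + 1) ≫ a = 0) :
    ∃ b : P.complex.X (n + 2) ⟶ G, P.complex.d (n + 1) (n + 2) ≫ b = a :=
  exists_ext_of_acyclic (P.proper G hG) (i := n + 1) (j := n + 2) (k := n + 3)
    (by simp) (by simp) a ha

theorem exists_cochainMap (P : ProperCoresolution X N) (Q : ProperCoresolution X N')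
    (f : N ⟶ N') : ∃ φ : P.complex ⟶ Q.complex, P.η ≫ φ.f 0 = f ≫ Q.η := by
  obtain ⟨z, hz⟩ := P.ext_zero (Q.mem 0) (f ≫ Q.η)
  obtain ⟨o, ho⟩ := P.ext_one (Q.mem 1) (z ≫ Q.complex.d 0 1) (by
    rw [← Category.assoc, hz, Category.assoc, Q.η_d, comp_zero])
  have hs : ∀ (n : ℕ) (g : P.complex.X n ⟶ Q.complex.X n)
      (g' : P.complex.X (n + 1) ⟶ Q.complex.X (n + 1))
      (_ : g ≫ Q.complex.d n (n + 1) = P.complex.d n (n + 1) ≫ g'),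
      ∃ g'' : P.complex.X (n + 2) ⟶ Q.complex.X (n + 2),
        g' ≫ Q.complex.d (n + 1) (n + 2) = P.complex.d (n + 1) (n + 2) ≫ g'' := by
    intro n g g' w
    obtain ⟨b, hb⟩ := P.ext_succ (Q.mem _) n (g' ≫ Q.complex.d (n + 1) (n + 2)) (by
      rw [← Category.assoc, ← w, Category.assoc, HomologicalComplex.d_comp_d, comp_zero])
    exact ⟨b, hb.symm⟩
  exact ⟨CochainComplex.mkHom _ _ z o ho.symm fun n p =>
    ⟨(hs n p.1 p.2.1 p.2.2).choose, (hs n p.1 p.2.1 p.2.2).choose_spec⟩, hz⟩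

theorem nonempty_homotopy_zero (P : ProperCoresolution X N) (Q : ProperCoresolution X N')
    (φ : P.complex ⟶ Q.complex) (h : P.η ≫ φ.f 0 = 0) : Nonempty (Homotopy φ 0) := by
  obtain ⟨z, hz⟩ := P.ext_one (Q.mem 0) (φ.f 0) h
  obtain ⟨o, ho⟩ := P.ext_succ (Q.mem 1) 0 (φ.f 1 - z ≫ Q.complex.d 0 1) (by
    rw [Preadditive.comp_sub, ← Category.assoc, hz, ← φ.comm, sub_self])
  have hs : ∀ (n : ℕ) (g : P.complex.X (n + 1) ⟶ Q.complex.X n)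
      (g' : P.complex.X (n + 2) ⟶ Q.complex.X (n + 1))
      (_ : φ.f (n + 1) = g ≫ Q.complex.d n (n + 1) + P.complex.d (n + 1) (n + 2) ≫ g'),
      ∃ g'' : P.complex.X (n + 3) ⟶ Q.complex.X (n + 2),
        φ.f (n + 2) = g' ≫ Q.complex.d (n + 1) (n + 2) + P.complex.d (n + 2) (n + 3) ≫ g'' := by
    intro n g g' w
    obtain ⟨b, hb⟩ := P.ext_succ (Q.mem _) (n + 1)
      (φ.f (n + 2) - g' ≫ Q.complex.d (n + 1) (n + 2)) (by
        rw [Preadditive.comp_sub, ← φ.comm, w]; simp)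
    exact ⟨b, by rw [hb]; abel⟩
  exact ⟨Homotopy.mkCoinductive _ z hz.symm o (by rw [ho]; abel) fun n p =>
    ⟨(hs n p.1 p.2.1 p.2.2).choose, (hs n p.1 p.2.1 p.2.2).choose_spec⟩⟩

theorem nonempty_homotopy (P : ProperCoresolution X N) (Q : ProperCoresolution X N')
    (φ ψ : P.complex ⟶ Q.complex) (h : P.η ≫ φ.f 0 = P.η ≫ ψ.f 0) : Nonempty (Homotopy φ ψ) :=
  (nonempty_homotopy_zero P Q (φ - ψ) (by
    rw [HomologicalComplex.sub_f_apply, Preadditive.comp_sub, h, sub_self])).map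
      Homotopy.equivSubZero.invFun

/-- A chosen cochain map of proper coresolutions over a morphism; it is unique up to homotopy. -/
def lift (P : ProperCoresolution X N) (Q : ProperCoresolution X N') (f : N ⟶ N') :
    P.complex ⟶ Q.complex :=
  (exists_cochainMap P Q f).choose

theorem η_lift (P : ProperCoresolution X N) (Q : ProperCoresolution X N') (f : N ⟶ N') :
    P.η ≫ (lift P Q f).f 0 = f ≫ Q.η :=
  (exists_cochainMap P Q f).choose_spec

end ProperCoresolution

variable (X)

/-- The objects that admit a proper left resolution by objects of `X`. -/
def HasProperResolution : ObjectProperty C := fun M => Nonempty (ProperResolution X M)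

/-- The objects that admit a proper right coresolution by objects of `X`. -/
def HasProperCoresolution : ObjectProperty C := fun N => Nonempty (ProperCoresolution X N)

/-- A chosen proper resolution. -/
def properResolution (M : (HasProperResolution X).FullSubcategory) : ProperResolution X M.obj :=
  M.property.some

/-- A chosen proper coresolution. -/
def properCoresolution (N : (HasProperCoresolution X).FullSubcategory) :
    ProperCoresolution X N.obj :=
  N.property.some

/-- The relative extension groups `Hⁿ(Hom(G_M, N))`, where `G_M ⟶ M` is a proper left resolution by
objects of `X`, as a functor in both variables. -/
def extOfResolution (n : ℕ) :
    (HasProperResolution X).FullSubcategoryᵒᵖ ⥤ C ⥤ AddCommGrpCat.{v} where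
  obj M := (homTo _).obj (op (properResolution X M.unop).complex) ⋙
    HomologicalComplex.homologyFunctor _ _ n
  map f := Functor.whiskerRight
    ((homTo _).map (ProperResolution.lift _ _ f.unop.hom).op) _
  map_id M := by
    ext N : 2
    obtain ⟨h⟩ := ProperResolution.nonempty_homotopy _ _
      (ProperResolution.lift (properResolution X M.unop) (properResolution X M.unop) (𝟙 _))
      (𝟙 _) (by rw [ProperResolution.lift_π]; simp)
    refine (homologyMap_homTo_eq h N n).trans ?_
    rw [op_id, CategoryTheory.Functor.map_id]
    exact HomologicalComplex.homologyMap_id _ _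
  map_comp {M₁ M₂ M₃} f g := by
    ext N : 2
    obtain ⟨h⟩ := ProperResolution.nonempty_homotopy _ _
      (ProperResolution.lift (properResolution X M₃.unop) (properResolution X M₁.unop)
        (g.unop.hom ≫ f.unop.hom))
      (ProperResolution.lift _ (properResolution X M₂.unop) g.unop.hom ≫
        ProperResolution.lift _ _ f.unop.hom) (by
          rw [ProperResolution.lift_π, HomologicalComplex.comp_f, Category.assoc,
            ProperResolution.lift_π, ← Category.assoc, ← Category.assoc,
            ProperResolution.lift_π])
    refine (homologyMap_homTo_eq h N n).trans ?_
    rw [op_comp, Functor.map_comp]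
    exact HomologicalComplex.homologyMap_comp _ _ _

/-- The relative extension groups `Hⁿ(Hom(M, R_N))`, where `N ⟶ R_N` is a proper right coresolution
by objects of `X`, as a functor in both variables. -/
def extOfCoresolution (n : ℕ) :
    Cᵒᵖ ⥤ (HasProperCoresolution X).FullSubcategory ⥤ AddCommGrpCat.{v} where
  obj M :=
    { obj := fun N => (((homFrom _).obj M).obj (properCoresolution X N).complex).homology n
      map := fun g => HomologicalComplex.homologyMap
        (((homFrom _).obj M).map (ProperCoresolution.lift _ _ g.hom)) n
      map_id := fun N => by
        obtain ⟨h⟩ := ProperCoresolution.nonempty_homotopy _ _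
          (ProperCoresolution.lift (properCoresolution X N) (properCoresolution X N) (𝟙 _))
          (𝟙 _) (by rw [ProperCoresolution.η_lift]; simp)
        refine (homologyMap_homFrom_eq h M n).trans ?_
        rw [CategoryTheory.Functor.map_id]
        exact HomologicalComplex.homologyMap_id _ _
      map_comp := fun {N₁ N₂ N₃} f g => by
        obtain ⟨h⟩ := ProperCoresolution.nonempty_homotopy _ _
          (ProperCoresolution.lift (properCoresolution X N₁) (properCoresolution X N₃)
            (f.hom ≫ g.hom))
          (ProperCoresolution.lift _ (properCoresolution X N₂) f.hom ≫
            ProperCoresolution.lift _ _ g.hom) (by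
              rw [ProperCoresolution.η_lift, HomologicalComplex.comp_f, ← Category.assoc,
                ProperCoresolution.η_lift, Category.assoc, Category.assoc,
                ProperCoresolution.η_lift])
        refine (homologyMap_homFrom_eq h M n).trans ?_
        rw [Functor.map_comp]
        exact HomologicalComplex.homologyMap_comp _ _ _ }
  map f :=
    { app := fun N => HomologicalComplex.homologyMap
        (((homFrom _).map f).app (properCoresolution X N).complex) n
      naturality := fun N₁ N₂ g => by
        dsimp only
        rw [← HomologicalComplex.homologyMap_comp, ← HomologicalComplex.homologyMap_comp,
          NatTrans.naturality] }
  map_id M := by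
    ext N : 2
    dsimp only
    rw [CategoryTheory.Functor.map_id]
    exact HomologicalComplex.homologyMap_id _ _
  map_comp f g := by
    ext N : 2
    dsimp only
    rw [Functor.map_comp]
    exact HomologicalComplex.homologyMap_comp _ _ _

end Relative

section Gorenstein

variable (A : Type u) [Ring A]

/-- `M` is Gorenstein-projective: it is the zeroth cocycle of a totally acyclic complex, i.e. of an
acyclic complex of projective modules which stays acyclic under `Hom(-, Q)` for each projective
module `Q`. The modules need not be finitely generated. -/
def GorensteinProjective : ObjectProperty (ModuleCat.{u} A) := fun M =>
  ∃ P : CochainComplex (ModuleCat.{u} A) ℤ,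
    (∀ i, Projective (P.X i)) ∧ P.Acyclic ∧
    (∀ Q : ModuleCat.{u} A, Projective Q → (((homTo _).obj (op P)).obj Q).Acyclic) ∧
    Nonempty (P.cycles 0 ≅ M)

/-- `N` is Gorenstein-injective: it is the zeroth coboundary of a cototally acyclic complex, i.e. of
an acyclic complex of injective modules which stays acyclic under `Hom(J, -)` for each injective
module `J`. The modules need not be finitely generated. -/
def GorensteinInjective : ObjectProperty (ModuleCat.{u} A) := fun N =>
  ∃ I : CochainComplex (ModuleCat.{u} A) ℤ,
    (∀ i, Injective (I.X i)) ∧ I.Acyclic ∧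
    (∀ J : ModuleCat.{u} A, Injective J → (((homFrom _).obj (op J)).obj I).Acyclic) ∧
    Nonempty (image (I.d (-1) 0) ≅ N)

/-- The modules that admit a proper Gorenstein-projective resolution. -/
abbrev GPResolvable : ObjectProperty (ModuleCat.{u} A) :=
  HasProperResolution (GorensteinProjective A)

/-- The modules that admit a proper Gorenstein-injective coresolution. -/
abbrev GIResolvable : ObjectProperty (ModuleCat.{u} A) :=
  HasProperCoresolution (GorensteinInjective A)

/-- The GP-extension groups `Ext_GPⁿ(M, N) = Hⁿ(Hom(G_M, N))`, with `G_M ⟶ M` a proper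
Gorenstein-projective resolution, as a functor in both variables. -/
abbrev extGP (n : ℕ) :
    (GPResolvable A).FullSubcategoryᵒᵖ ⥤ ModuleCat.{u} A ⥤ AddCommGrpCat.{u} :=
  extOfResolution (GorensteinProjective A) n

/-- The GI-extension groups `Ext_GIⁿ(M, N) = Hⁿ(Hom(M, R_N))`, with `N ⟶ R_N` a proper
Gorenstein-injective coresolution, as a functor in both variables. -/
abbrev extGI (n : ℕ) :
    (ModuleCat.{u} A)ᵒᵖ ⥤ (GIResolvable A).FullSubcategory ⥤ AddCommGrpCat.{u} :=
  extOfCoresolution (GorensteinInjective A) n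

variable {A}

/-- The Gorenstein-projective dimension `sup {n ≥ 0 | Ext_GPⁿ(M, -) ≠ 0}`. -/
def gpDim (M : (GPResolvable A).FullSubcategory) : ℕ∞ :=
  ⨆ (n : ℕ) (_ : ∃ N, ¬ IsZero (((extGP A n).obj (op M)).obj N)), (n : ℕ∞)

/-- The Gorenstein-injective dimension `sup {n ≥ 0 | Ext_GIⁿ(-, N) ≠ 0}`. -/
def giDim (N : (GIResolvable A).FullSubcategory) : ℕ∞ :=
  ⨆ (n : ℕ) (_ : ∃ M, ¬ IsZero (((extGI A n).obj M).obj N)), (n : ℕ∞)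

variable (A)

/-- The modules of finite Gorenstein-projective dimension. -/
def FiniteGPDim : ObjectProperty (ModuleCat.{u} A) := fun M =>
  ∃ h : GPResolvable A M, gpDim ⟨M, h⟩ < ⊤

/-- The modules of finite Gorenstein-injective dimension. -/
def FiniteGIDim : ObjectProperty (ModuleCat.{u} A) := fun N =>
  ∃ h : GIResolvable A N, giDim ⟨N, h⟩ < ⊤

theorem finiteGPDim_le : FiniteGPDim A ≤ GPResolvable A := fun _ h => h.1

theorem finiteGIDim_le : FiniteGIDim A ≤ GIResolvable A := fun _ h => h.1

/-- `Ext_GPⁿ(M, N)` as a functor in `M` of finite Gorenstein-projective dimension and `N` of finite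
Gorenstein-injective dimension. -/
def extGPFinite (n : ℕ) :
    (FiniteGPDim A).FullSubcategoryᵒᵖ ⥤ (FiniteGIDim A).FullSubcategory ⥤ AddCommGrpCat.{u} :=
  (ObjectProperty.ιOfLE (finiteGPDim_le A)).op ⋙ extGP A n ⋙
    (Functor.whiskeringLeft _ _ _).obj (FiniteGIDim A).ι

/-- `Ext_GIⁿ(M, N)` as a functor in `M` of finite Gorenstein-projective dimension and `N` of finite
Gorenstein-injective dimension. -/
def extGIFinite (n : ℕ) :
    (FiniteGPDim A).FullSubcategoryᵒᵖ ⥤ (FiniteGIDim A).FullSubcategory ⥤ AddCommGrpCat.{u} :=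
  (FiniteGPDim A).ι.op ⋙ extGI A n ⋙
    (Functor.whiskeringLeft _ _ _).obj (ObjectProperty.ιOfLE (finiteGIDim_le A))

end Gorenstein

end

end GorensteinHom

/-!
Let `M` have a proper Gorenstein projective resolution for which `Ext_GP(M, -)` vanishes in high
degrees. Its far-out cycles are then retracts of its terms, hence Gorenstein projective, and
descending from there every cycle `Z`, including `M`, acquires an approximation
`0 ⟶ H ⟶ G ⟶ Z ⟶ 0` with `G` Gorenstein projective and `H` of finite projective dimension. A
Gorenstein injective module `R` is an arbitrarily high injective syzygy, so dimension shifting gives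
`Ext(H, R) = 0` in positive degrees and morphisms `H ⟶ R` extend along monomorphisms. Since the
resolution is proper, it can be compared with these approximations, and so `Hom(-, R)` keeps the
augmented resolution exact. Dually, `Hom(G, -)` keeps augmented coresolutions exact for Gorenstein
projective `G`. The rows and columns of the bicomplex `Hom(Gₚ, R^q)` are therefore exact except at
the two edges computing the extension groups, and the zigzags in it connecting a cocycle of one edge
with a cocycle of the other induce the graph of an isomorphism on homology. Chain maps preserve
zigzags, whence the naturality.

Gorenstein injective objects are treated as Gorenstein projective objects of the opposite category.
-/

namespace GorensteinHom

open Abelian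

section ShortExactSequences

variable {C : Type u} [Category.{v} C] [Abelian C] {S : ShortComplex C}

theorem exists_shortExact_of_isPushout (hS : S.ShortExact) {X Y : C} {a : S.X₁ ⟶ X}
    {b : S.X₂ ⟶ Y} {f : X ⟶ Y} (hp : IsPushout S.f a b f) :
    ∃ (g : Y ⟶ S.X₃) (w : f ≫ g = 0), b ≫ g = S.g ∧ (ShortComplex.mk f g w).ShortExact := by
  have := hS.mono_f
  have := hS.epi_g
  let g : Y ⟶ S.X₃ := hp.desc S.g 0 (by rw [S.zero, comp_zero])
  have hbg : b ≫ g = S.g := hp.inl_desc ..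
  have hfg : f ≫ g = 0 := hp.inr_desc ..
  have : Mono f := (MorphismProperty.monomorphisms C).of_isPushout hp.flip hS.mono_f
  have : Epi g := epi_of_epi_fac hbg
  refine ⟨g, hfg, hbg, .mk (ShortComplex.exact_of_g_is_cokernel _
    (CokernelCofork.IsColimit.ofπ' g hfg fun {T} k hk => ?_))⟩
  have hbk : S.f ≫ b ≫ k = 0 := by rw [hp.w_assoc, hk, comp_zero]
  refine ⟨hS.exact.desc (b ≫ k) hbk, hp.hom_ext ?_ ?_⟩
  · rw [← Category.assoc, hbg, hS.exact.g_desc]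
  · rw [← Category.assoc, hfg, zero_comp, hk]

theorem exists_shortExact_comp_of_isPushout (hS : S.ShortExact) {Y Z : C} {j : S.X₂ ⟶ Y} [Mono j]
    {b : Y ⟶ Z} {k : S.X₃ ⟶ Z} (hp : IsPushout j S.g b k) :
    ∃ w : (S.f ≫ j) ≫ b = 0, (ShortComplex.mk (S.f ≫ j) b w).ShortExact := by
  have := hS.mono_f
  have := hS.epi_g
  have : Epi b := (MorphismProperty.epimorphisms C).of_isPushout hp hS.epi_g
  have w : (S.f ≫ j) ≫ b = 0 := by rw [Category.assoc, hp.w, S.zero_assoc, zero_comp]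
  refine ⟨w, .mk (ShortComplex.exact_of_g_is_cokernel _
    (CokernelCofork.IsColimit.ofπ' b w fun {T} t ht => ?_))⟩
  have ht' : S.f ≫ j ≫ t = 0 := by rw [← Category.assoc, ht]
  exact ⟨hp.desc t (hS.exact.desc (j ≫ t) ht') (hS.exact.g_desc _ _).symm, hp.inl_desc ..⟩

theorem exists_shortExact_projective_of_retraction (hS : S.ShortExact) [Projective S.X₁]
    {r : S.X₂ ⟶ S.X₁} (hr : S.f ≫ r = 𝟙 _) {P Y : C} {i : S.X₃ ⟶ P} {p : P ⟶ Y} {w : i ≫ p = 0}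
    (hi : (ShortComplex.mk i p w).ShortExact) [Projective P] :
    ∃ (Q : C) (j : S.X₂ ⟶ Q) (q : Q ⟶ Y) (w : j ≫ q = 0),
      (ShortComplex.mk j q w).ShortExact ∧ Projective Q := by
  let σ := ShortComplex.Splitting.ofExactOfRetraction S hS.exact r hr hS.epi_g
  have hσ : (ShortComplex.mk σ.s r σ.s_r).ShortExact :=
    ShortComplex.Splitting.shortExact
      { r := S.g, s := S.f, f_r := σ.s_g, s_g := hr, id := (add_comm _ _).trans σ.id }
  have hp := IsPushout.of_hasPushout σ.s i
  obtain ⟨q, wq, -, hq⟩ := exists_shortExact_of_isPushout hi hp.flip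
  obtain ⟨_, _, -, hQ⟩ := exists_shortExact_of_isPushout hσ hp
  have : HasProjectiveDimensionLT (pushout σ.s i) 1 :=
    hQ.hasProjectiveDimensionLT_X₂ 1 inferInstance inferInstance
  exact ⟨_, _, q, wq, hq, inferInstance⟩

end ShortExactSequences

section Ext

variable {C : Type u} [Category.{v} C] [Abelian C] [HasExt.{w} C] {S : ShortComplex C} {W : C}

theorem exists_f_comp_eq (hS : S.ShortExact) [hW : Subsingleton (Ext S.X₃ W 1)] (a : S.X₁ ⟶ W) :
    ∃ b : S.X₂ ⟶ W, S.f ≫ b = a := by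
  obtain ⟨x, hx⟩ :=
    Ext.contravariant_sequence_exact₁ hS _ (Ext.mk₀ a) (n₁ := 1) rfl (hW.elim _ _)
  obtain ⟨b, rfl⟩ := (Ext.mk₀_bijective _ _).2 x
  exact ⟨b, (Ext.mk₀_bijective _ _).1 (by rw [← Ext.mk₀_comp_mk₀]; exact hx)⟩

theorem exists_comp_g_eq (hS : S.ShortExact) [hW : Subsingleton (Ext W S.X₁ 1)] (a : W ⟶ S.X₃) :
    ∃ b : W ⟶ S.X₂, b ≫ S.g = a := by
  obtain ⟨x, hx⟩ := Ext.covariant_sequence_exact₃ _ hS (Ext.mk₀ a) (zero_add 1) (hW.elim _ _)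
  obtain ⟨b, rfl⟩ := (Ext.mk₀_bijective _ _).2 x
  exact ⟨b, (Ext.mk₀_bijective _ _).1 (by rw [← Ext.mk₀_comp_mk₀]; exact hx)⟩

theorem subsingleton_ext_one_X₃ (hS : S.ShortExact) [hW : Subsingleton (Ext S.X₂ W 1)]
    (hext : ∀ a : S.X₁ ⟶ W, ∃ b, S.f ≫ b = a) : Subsingleton (Ext S.X₃ W 1) := by
  refine subsingleton_of_forall_eq 0 fun x => ?_
  obtain ⟨y, rfl⟩ := Ext.contravariant_sequence_exact₃ hS _ x (hW.elim _ _) (n₀ := 0) rfl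
  obtain ⟨a, rfl⟩ := (Ext.mk₀_bijective _ _).2 y
  obtain ⟨b, rfl⟩ := hext a
  rw [← Ext.mk₀_comp_mk₀]
  exact hS.extClass_comp_assoc _

theorem subsingleton_ext_X₁ (hS : S.ShortExact) (n : ℕ) [h₂ : Subsingleton (Ext S.X₂ W n)]
    [h₃ : Subsingleton (Ext S.X₃ W (n + 1))] : Subsingleton (Ext S.X₁ W n) := by
  refine subsingleton_of_forall_eq 0 fun x => ?_
  obtain ⟨y, rfl⟩ := Ext.contravariant_sequence_exact₁ hS _ x (add_comm 1 n) (h₃.elim _ _)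
  rw [h₂.elim y 0, Ext.comp_zero]

theorem subsingleton_ext_X₂ (hS : S.ShortExact) (n : ℕ) [h₁ : Subsingleton (Ext S.X₁ W n)]
    [h₃ : Subsingleton (Ext S.X₃ W n)] : Subsingleton (Ext S.X₂ W n) := by
  refine subsingleton_of_forall_eq 0 fun x => ?_
  obtain ⟨y, rfl⟩ := Ext.contravariant_sequence_exact₂ hS _ x (h₁.elim _ _)
  rw [h₃.elim y 0, Ext.comp_zero]

theorem subsingleton_ext_X₃ (hS : S.ShortExact) (n : ℕ) [h₁ : Subsingleton (Ext S.X₁ W n)]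
    [h₂ : Subsingleton (Ext S.X₂ W (n + 1))] : Subsingleton (Ext S.X₃ W (n + 1)) := by
  refine subsingleton_of_forall_eq 0 fun x => ?_
  obtain ⟨y, rfl⟩ := Ext.contravariant_sequence_exact₃ hS _ x (h₂.elim _ _) (add_comm 1 n)
  rw [h₁.elim y 0, Ext.comp_zero]

theorem subsingleton_ext_to_X₃ (hS : S.ShortExact) (n : ℕ) [h₂ : Subsingleton (Ext W S.X₂ n)]
    [h₁ : Subsingleton (Ext W S.X₁ (n + 1))] : Subsingleton (Ext W S.X₃ n) := by
  refine subsingleton_of_forall_eq 0 fun x => ?_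
  obtain ⟨y, rfl⟩ := Ext.covariant_sequence_exact₃ _ hS x rfl (h₁.elim _ _)
  rw [h₂.elim y 0, Ext.zero_comp]

theorem subsingleton_ext_of_retract {X Y : C} (h : Retract X Y) (n : ℕ)
    [hY : Subsingleton (Ext Y W n)] : Subsingleton (Ext X W n) := by
  refine subsingleton_of_forall_eq 0 fun x => ?_
  rw [← Ext.mk₀_id_comp x, ← h.retract, ← Ext.mk₀_comp_mk₀_assoc,
    hY.elim ((Ext.mk₀ h.r).comp x (zero_add n)) 0, Ext.comp_zero]

end Ext

section GorensteinProjectiveObjects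

variable {C : Type u} [Category.{v} C] [Abelian C] [HasExt.{w} C]

/-- The operator on classes of objects whose greatest fixed point is the class of Gorenstein
projective objects: `gorensteinStep T` consists of the objects without higher extensions into
projective objects which embed into a projective object with cokernel in `T`. -/
def gorensteinStep : ObjectProperty C →o ObjectProperty C where
  toFun T X := (∀ (Q : C) [Projective Q] (n : ℕ), Subsingleton (Ext X Q (n + 1))) ∧
    ∃ (P Y : C) (i : X ⟶ P) (p : P ⟶ Y) (w : i ≫ p = 0),
      (ShortComplex.mk i p w).ShortExact ∧ Projective P ∧ T Y
  monotone' _ _ h _ := fun ⟨hX, P, Y, i, p, w, hS, hP, hY⟩ => ⟨hX, P, Y, i, p, w, hS, hP, h _ hY⟩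

/-- The Gorenstein projective objects of an abelian category, described coinductively: such an
object has no higher extensions into projective objects, and it embeds into a projective object with
Gorenstein projective cokernel. When there are enough projective objects, these are the cocycles of
the totally acyclic complexes of projective objects. -/
def IsGorensteinProjective : ObjectProperty C := gorensteinStep.gfp

variable {X Y : C}

namespace IsGorensteinProjective

theorem gorensteinStep (hX : IsGorensteinProjective X) :
    GorensteinHom.gorensteinStep IsGorensteinProjective X :=
  GorensteinHom.gorensteinStep.map_gfp.ge _ hX

theorem of_gorensteinStep (hX : GorensteinHom.gorensteinStep IsGorensteinProjective X) :
    IsGorensteinProjective X :=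
  GorensteinHom.gorensteinStep.map_gfp.le _ hX

theorem coinduction {T : ObjectProperty C} (hT : T ≤ GorensteinHom.gorensteinStep T) :
    T ≤ IsGorensteinProjective :=
  GorensteinHom.gorensteinStep.le_gfp hT

theorem subsingleton_ext (hX : IsGorensteinProjective X) (Q : C) [Projective Q] (n : ℕ) :
    Subsingleton (Ext X Q (n + 1)) :=
  hX.gorensteinStep.1 Q n

theorem exists_shortExact (hX : IsGorensteinProjective X) :
    ∃ (P Y : C) (i : X ⟶ P) (p : P ⟶ Y) (w : i ≫ p = 0),
      (ShortComplex.mk i p w).ShortExact ∧ Projective P ∧ IsGorensteinProjective Y :=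
  hX.gorensteinStep.2

theorem X₁_of_projective {S : ShortComplex C} (hS : S.ShortExact) [Projective S.X₂]
    (h : IsGorensteinProjective S.X₃) : IsGorensteinProjective S.X₁ :=
  of_gorensteinStep ⟨fun Q _ n =>
    have := Ext.subsingleton_of_projective S.X₂ Q n
    have := h.subsingleton_ext Q (n + 1)
    subsingleton_ext_X₁ hS _, _, _, _, _, _, hS, inferInstance, h⟩

theorem X₂ {S : ShortComplex C} (hS : S.ShortExact)
    (h₁ : IsGorensteinProjective S.X₁) (h₃ : IsGorensteinProjective S.X₃) :
    IsGorensteinProjective S.X₂ := by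
  let T : ObjectProperty C := fun E => ∃ S : ShortComplex C, S.ShortExact ∧
    IsGorensteinProjective S.X₁ ∧ IsGorensteinProjective S.X₃ ∧ S.X₂ = E
  refine coinduction (T := T) ?_ _ ⟨S, hS, h₁, h₃, rfl⟩
  rintro _ ⟨S, hS, h₁, h₃, rfl⟩
  refine ⟨fun Q _ n => ?_, ?_⟩
  · have := h₁.subsingleton_ext Q n
    have := h₃.subsingleton_ext Q n
    exact subsingleton_ext_X₂ hS _
  obtain ⟨P₁, Y₁, i₁, p₁, w₁, hS₁, hP₁, hY₁⟩ := h₁.exists_shortExact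
  obtain ⟨P₃, Y₃, i₃, p₃, w₃, hS₃, hP₃, hY₃⟩ := h₃.exists_shortExact
  have := hS₁.mono_f
  have := hS₃.mono_f
  have hF := IsPushout.of_hasPushout S.f i₁
  obtain ⟨q, wq, -, hq⟩ := exists_shortExact_of_isPushout hS hF
  obtain ⟨c, wc, -, hc⟩ := exists_shortExact_of_isPushout hS₁ hF.flip
  have := h₃.subsingleton_ext P₁ 0
  obtain ⟨r, hr⟩ := exists_f_comp_eq hq (𝟙 P₁)
  obtain ⟨Q, j, d, wd, hd, hQ⟩ := exists_shortExact_projective_of_retraction hq hr hS₃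
  have := hd.mono_f
  have hY := IsPushout.of_hasPushout j c
  obtain ⟨w, hw⟩ := exists_shortExact_comp_of_isPushout hc hY
  obtain ⟨_, _, -, hY'⟩ := exists_shortExact_of_isPushout hd hY
  exact ⟨_, _, _, _, w, hw, hQ, _, hY', hY₁, hY₃, rfl⟩

/-- Let `X` be a retract of `Y`. If `Y` embeds into `P`, then `P / X` is a retract of the pushout
of `P` along the idempotent of `Y` that projects to the complement of `X`. -/
theorem of_retract (h : Retract X Y) (hY : IsGorensteinProjective Y) :
    IsGorensteinProjective X := by
  let T : ObjectProperty C := fun X => ∃ Y, Nonempty (Retract X Y) ∧ IsGorensteinProjective Y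
  refine coinduction (T := T) ?_ _ ⟨Y, ⟨h⟩, hY⟩
  rintro X ⟨Y, ⟨h⟩, hY⟩
  refine ⟨fun Q _ n => ?_, ?_⟩
  · have := hY.subsingleton_ext Q n
    exact subsingleton_ext_of_retract h _
  obtain ⟨P, Y', j, p, w, hj, hP, hY'⟩ := hY.exists_shortExact
  have := hj.mono_f
  have : Mono h.i := mono_of_mono_fac h.retract
  let k : X ⟶ P := h.i ≫ j
  have hc : (ShortComplex.mk k (cokernel.π k) (cokernel.condition k)).ShortExact :=
    .mk (ShortComplex.exact_cokernel k)
  let e : Y ⟶ Y := 𝟙 Y - h.r ≫ h.i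
  have hp := IsPushout.of_hasPushout j e
  obtain ⟨_, _, -, hE⟩ := exists_shortExact_of_isPushout hj hp
  have hie : h.i ≫ e = 0 := by simp [e]
  have hij : h.i ≫ j ≫ cokernel.π k = 0 := by rw [← Category.assoc, cokernel.condition]
  refine ⟨P, cokernel k, k, _, cokernel.condition k, hc, hP, pushout j e,
    ⟨{ i := cokernel.desc k (pushout.inl j e)
        (by rw [Category.assoc, hp.w, reassoc_of% hie, zero_comp])
       r := hp.desc (cokernel.π k) (j ≫ cokernel.π k) (by simp [e, hij])
       retract := ?_ }⟩, X₂ hE hY hY'⟩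
  rw [← cancel_epi (cokernel.π k), cokernel.π_desc_assoc, hp.inl_desc, Category.comp_id]

theorem of_iso (hX : IsGorensteinProjective X) (e : X ≅ Y) : IsGorensteinProjective Y :=
  of_retract (Retract.ofIso e.symm) hX

end IsGorensteinProjective

end GorensteinProjectiveObjects

section FiniteProjectiveDimension

variable {C : Type u} [Category.{v} C] [Abelian C]

/-- The objects of finite projective dimension. -/
def HasFiniteProjectiveDimension : ObjectProperty C := fun H => ∃ n, HasProjectiveDimensionLT H n

theorem HasFiniteProjectiveDimension.X₃_of_projective {S : ShortComplex C} (hS : S.ShortExact)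
    [Projective S.X₂] (h : HasFiniteProjectiveDimension S.X₁) :
    HasFiniteProjectiveDimension S.X₃ := by
  obtain ⟨n, hn⟩ := h
  exact ⟨max n 1 + 1, hS.hasProjectiveDimensionLT_X₃ (max n 1)
    (hasProjectiveDimensionLT_of_ge _ n _ (le_max_left ..))
    (hasProjectiveDimensionLT_of_ge _ 1 _ ((le_max_right ..).trans (Nat.le_succ _)))⟩

variable [HasExt.{w} C]

theorem IsGorensteinProjective.subsingleton_ext_of_hasFiniteProjectiveDimension
    [EnoughProjectives C] {X H : C} (hX : IsGorensteinProjective X)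
    (hH : HasFiniteProjectiveDimension H) (n : ℕ) : Subsingleton (Ext X H (n + 1)) := by
  obtain ⟨d, hd⟩ := hH
  replace hd := hasProjectiveDimensionLT_of_ge H d (d + 1) d.le_succ
  induction d generalizing H n with
  | zero =>
    have := projective_iff_hasProjectiveDimensionLT_one.2 hd
    exact hX.subsingleton_ext H n
  | succ d ih =>
    let S : ShortComplex C := ShortComplex.mk _ _ (kernel.condition (Projective.π H))
    have hS : S.ShortExact := .mk (ShortComplex.exact_kernel _)
    have hP : Projective S.X₂ := inferInstanceAs (Projective (Projective.over H))
    have hd' := (hS.hasProjectiveDimensionLT_X₃_iff d hP).1 hd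
    have := hX.subsingleton_ext S.X₂ n
    have := ih (n + 1) hd'
    exact subsingleton_ext_to_X₃ hS _

theorem subsingleton_ext_of_injective_syzygies {T : ObjectProperty C}
    (hT : ∀ R, T R → ∃ S : ShortComplex C, S.ShortExact ∧ Injective S.X₂ ∧ T S.X₁ ∧ S.X₃ = R)
    {H R : C} (hH : HasFiniteProjectiveDimension H) (hR : T R) (n : ℕ) :
    Subsingleton (Ext H R (n + 1)) := by
  obtain ⟨d, hd⟩ := hH
  suffices ∀ (k n : ℕ) (R : C), T R → d ≤ n + 1 + k → Subsingleton (Ext H R (n + 1)) from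
    this d n R hR (by lia)
  intro k
  induction k with
  | zero => exact fun n R _ hn => HasProjectiveDimensionLT.subsingleton H d _ hn _
  | succ k ih =>
    intro n R hR hn
    obtain ⟨S, hS, _, hS', rfl⟩ := hT R hR
    have := ih (n + 1) _ hS' (by lia)
    have := Ext.subsingleton_of_injective H S.X₂ n
    exact subsingleton_ext_to_X₃ hS _

/-- The objects `R` such that morphisms into `R` from an object of finite projective dimension
extend along monomorphisms. -/
def IsInjectiveForFiniteProjectiveDimension : ObjectProperty C := fun R =>
  ∀ ⦃H G : C⦄ (h : H ⟶ G) [Mono h], HasFiniteProjectiveDimension H →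
    ∀ a : H ⟶ R, ∃ b, h ≫ b = a

theorem isInjectiveForFiniteProjectiveDimension_of_syzygies {T : ObjectProperty C}
    (hT : ∀ R, T R → ∃ S : ShortComplex C, S.ShortExact ∧ Injective S.X₂ ∧ T S.X₁ ∧ S.X₃ = R) :
    T ≤ IsInjectiveForFiniteProjectiveDimension := by
  intro R hR H G h _ hH a
  obtain ⟨S, hS, _, hS', rfl⟩ := hT R hR
  have := subsingleton_ext_of_injective_syzygies hT hH hS' 0
  obtain ⟨t, rfl⟩ := exists_comp_g_eq hS a
  exact ⟨Injective.factorThru t h ≫ S.g, by simp⟩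

theorem IsGorensteinProjective.isInjectiveForFiniteProjectiveDimension_unop [HasExt.{w} Cᵒᵖ]
    {R : C} (hR : IsGorensteinProjective (op R)) : IsInjectiveForFiniteProjectiveDimension R := by
  refine isInjectiveForFiniteProjectiveDimension_of_syzygies
    (T := fun R => IsGorensteinProjective (op R)) (fun R hR => ?_) R hR
  obtain ⟨P, Y, i, p, w, hS, hP, hY⟩ := hR.exists_shortExact
  exact ⟨_, hS.unop, inferInstanceAs (Injective P.unop), hY, rfl⟩

theorem IsGorensteinProjective.isInjectiveForFiniteProjectiveDimension_op [HasExt.{w} Cᵒᵖ]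
    {G : C} (hG : IsGorensteinProjective G) :
    IsInjectiveForFiniteProjectiveDimension (op G) := by
  refine isInjectiveForFiniteProjectiveDimension_of_syzygies
    (T := fun R => IsGorensteinProjective R.unop) (fun R hR => ?_) (op G) hG
  obtain ⟨P, Y, i, p, w, hS, hP, hY⟩ := hR.exists_shortExact
  exact ⟨_, hS.op, inferInstanceAs (Injective (op P)), hY, rfl⟩

end FiniteProjectiveDimension

section Approximations

variable {C : Type u} [Category.{v} C] [Abelian C]

theorem exists_comp_eq_of_comparison {M K X H G : C} {k : K ⟶ X} {q : X ⟶ M} {h : H ⟶ G}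
    {p : G ⟶ M} {wq : k ≫ q = 0} {wp : h ≫ p = 0} (hq : (ShortComplex.mk k q wq).ShortExact)
    (hp : (ShortComplex.mk h p wp).ShortExact) {u : X ⟶ G} {v : G ⟶ X} (hu : u ≫ p = q)
    (hv : v ≫ q = p) {R : C} (hR : ∀ a : H ⟶ R, ∃ b, h ≫ b = a) (a : K ⟶ R) :
    ∃ b, k ≫ b = a := by
  have : Mono k := hq.mono_f
  have : Mono h := hp.mono_f
  obtain ⟨u', hu'⟩ : ∃ u', u' ≫ h = k ≫ u :=
    ⟨_, hp.exact.lift_f (k ≫ u) (by rw [Category.assoc, hu, wq])⟩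
  obtain ⟨v', hv'⟩ : ∃ v', v' ≫ k = h ≫ v :=
    ⟨_, hq.exact.lift_f (h ≫ v) (by rw [Category.assoc, hv, wp])⟩
  obtain ⟨s, hs⟩ : ∃ s, s ≫ k = 𝟙 X - u ≫ v :=
    ⟨_, hq.exact.lift_f (𝟙 X - u ≫ v) (by simp [hu, hv])⟩
  have hks : k ≫ s = 𝟙 K - u' ≫ v' := by
    rw [← cancel_mono k]
    simp [hs, hv', reassoc_of% hu']
  obtain ⟨b, hb⟩ := hR (v' ≫ a)
  refine ⟨u ≫ b + s ≫ a, ?_⟩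
  rw [Preadditive.comp_add, ← reassoc_of% hu', hb, reassoc_of% hks]
  simp

variable [HasExt.{w} C]

/-- The objects `M` with a Gorenstein projective approximation, i.e. a short exact sequence
`0 ⟶ H ⟶ G ⟶ M ⟶ 0` with `G` Gorenstein projective and `H` of finite projective dimension. -/
def HasApproximation : ObjectProperty C := fun M =>
  ∃ (H G : C) (i : H ⟶ G) (p : G ⟶ M) (w : i ≫ p = 0), (ShortComplex.mk i p w).ShortExact ∧
    HasFiniteProjectiveDimension H ∧ IsGorensteinProjective G

namespace HasApproximation

theorem of_isGorensteinProjective {G : C} (hG : IsGorensteinProjective G) : HasApproximation G :=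
  ⟨kernel (𝟙 G), G, _, 𝟙 G, kernel.condition _, .mk (ShortComplex.exact_kernel _),
    ⟨0, (isZero_kernel_of_mono _).hasProjectiveDimensionLT_zero⟩, hG⟩

theorem X₃ {S : ShortComplex C} (hS : S.ShortExact) (h₁ : HasApproximation S.X₁)
    (h₂ : IsGorensteinProjective S.X₂) : HasApproximation S.X₃ := by
  obtain ⟨H, G, i, p, w, hp, hH, hG⟩ := h₁
  obtain ⟨P, G', j, q, wq, hj, hP, hG'⟩ := hG.exists_shortExact
  have := hj.mono_f
  have hL := IsPushout.of_hasPushout j p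
  obtain ⟨_, hHL⟩ := exists_shortExact_comp_of_isPushout hp hL
  obtain ⟨_, _, -, hKL⟩ := exists_shortExact_of_isPushout hj hL
  have hE := IsPushout.of_hasPushout S.f (pushout.inr j p)
  obtain ⟨_, _, -, hLE⟩ := exists_shortExact_of_isPushout hS hE
  obtain ⟨_, _, -, hGE⟩ := exists_shortExact_of_isPushout hKL hE.flip
  exact ⟨_, _, _, _, _, hLE, .X₃_of_projective hHL hH, .X₂ hGE h₂ hG'⟩

end HasApproximation

theorem HasApproximation.exists_comp_eq [EnoughProjectives C] {S : ShortComplex C}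
    (hS : S.ShortExact) (h₃ : HasApproximation S.X₃) (h₂ : IsGorensteinProjective S.X₂)
    (hlift : ∀ G, IsGorensteinProjective G → ∀ a : G ⟶ S.X₃, ∃ b, b ≫ S.g = a) {R : C}
    (hR : IsInjectiveForFiniteProjectiveDimension R) (a : S.X₁ ⟶ R) : ∃ b, S.f ≫ b = a := by
  obtain ⟨H, G, i, p, w, hp, hH, hG⟩ := h₃
  have : Mono i := hp.mono_f
  have := h₂.subsingleton_ext_of_hasFiniteProjectiveDimension hH 0
  obtain ⟨u, hu⟩ := exists_comp_g_eq hp S.g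
  obtain ⟨v, hv⟩ := hlift G hG p
  exact exists_comp_eq_of_comparison hS hp hu hv (hR i hH) a

end Approximations

section HomExactness

variable {C : Type u} [Category.{v} C] {ι : Type w} {c : ComplexShape ι}

section Preadditive

variable [Preadditive C] {K : HomologicalComplex C c} {G : C} {i j k : ι}

theorem exactAt_homTo_iff (hi : c.prev j = i) (hk : c.next j = k) :
    (((homTo c).obj (op K)).obj G).ExactAt j ↔
      ∀ a : K.X j ⟶ G, K.d i j ≫ a = 0 → ∃ b : K.X k ⟶ G, K.d j k ≫ b = a := by
  rw [HomologicalComplex.exactAt_iff' _ k j i (show c.symm.prev j = k from hk)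
    (show c.symm.next j = i from hi), ShortComplex.ab_exact_iff]
  rfl

theorem exactAt_homFrom_iff (hi : c.prev j = i) (hk : c.next j = k) :
    (((homFrom c).obj (op G)).obj K).ExactAt j ↔
      ∀ a : G ⟶ K.X j, a ≫ K.d j k = 0 → ∃ b : G ⟶ K.X i, b ≫ K.d i j = a := by
  rw [HomologicalComplex.exactAt_iff' _ i j k hi hk, ShortComplex.ab_exact_iff]
  rfl

theorem exactAt_homTo_op_iff :
    (((homTo c.symm).obj (op K.op)).obj (op G)).ExactAt j ↔
      (((homFrom c).obj (op G)).obj K).ExactAt j := by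
  rw [exactAt_homTo_iff rfl rfl, exactAt_homFrom_iff rfl rfl]
  exact ⟨fun h a ha => (h a.op (congrArg Quiver.Hom.op ha)).imp' Quiver.Hom.unop
    fun b hb => congrArg Quiver.Hom.unop hb,
    fun h a ha => (h a.unop (congrArg Quiver.Hom.unop ha)).imp' Quiver.Hom.op
    fun b hb => congrArg Quiver.Hom.op hb⟩

theorem exactAt_homFrom_op_iff :
    (((homFrom c.symm).obj (op (op G))).obj K.op).ExactAt j ↔
      (((homTo c).obj (op K)).obj G).ExactAt j := by
  rw [exactAt_homTo_iff rfl rfl, exactAt_homFrom_iff rfl rfl]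
  exact ⟨fun h a ha => (h a.op (congrArg Quiver.Hom.op ha)).imp' Quiver.Hom.unop
    fun b hb => congrArg Quiver.Hom.unop hb,
    fun h a ha => (h a.unop (congrArg Quiver.Hom.unop ha)).imp' Quiver.Hom.op
    fun b hb => congrArg Quiver.Hom.op hb⟩

end Preadditive

variable [Abelian C] {K : HomologicalComplex C c} {G : C} {i j : ι}

theorem epi_toCycles (hi : c.prev j = i) (hK : K.ExactAt j) : Epi (K.toCycles i j) := by
  have h := (ShortComplex.exact_iff_epi_toCycles _).1 ((K.exactAt_iff' i j _ hi rfl).1 hK)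
  rw [← K.toCycles_cyclesIsoSc'_hom i j _ hi rfl] at h
  exact (epi_comp_iff_of_isIso _ _).1 h

theorem d_comp_eq_zero_iff (hi : c.prev j = i) (hK : K.ExactAt j) (a : K.X j ⟶ G) :
    K.d i j ≫ a = 0 ↔ K.iCycles j ≫ a = 0 := by
  have := epi_toCycles hi hK
  rw [← K.toCycles_i, Category.assoc, ← comp_zero (f := K.toCycles i j), cancel_epi]

/-- The short complex `0 ⟶ Zᵢ ⟶ Kᵢ ⟶ Zⱼ ⟶ 0` of cycles of `K`. -/
@[simps]
noncomputable def cyclesSequence (K : HomologicalComplex C c) (i j : ι) : ShortComplex C where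
  X₁ := K.cycles i
  X₂ := K.X i
  X₃ := K.cycles j
  f := K.iCycles i
  g := K.toCycles i j
  zero := by rw [← cancel_mono (K.iCycles j), Category.assoc, K.toCycles_i, K.iCycles_d, zero_comp]

theorem cyclesSequence_shortExact (hij : c.Rel i j) (hK : K.ExactAt j) :
    (cyclesSequence K i j).ShortExact where
  exact := (cyclesSequence K i j).exact_of_f_is_kernel
    (KernelFork.IsLimit.ofι' (K.iCycles i) (cyclesSequence K i j).zero fun k hk =>
      ⟨K.liftCycles k j (c.next_eq' hij)
        (by rw [← K.toCycles_i, ← Category.assoc, show k ≫ K.toCycles i j = 0 from hk, zero_comp]),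
        K.liftCycles_i _ _ _ _⟩)
  mono_f := inferInstanceAs (Mono (K.iCycles i))
  epi_g := epi_toCycles (c.prev_eq' hij) hK

theorem exactAt_homTo_iff_cycles (hij : c.Rel i j) (hi : K.ExactAt i) (hj : K.ExactAt j) :
    (((homTo c).obj (op K)).obj G).ExactAt i ↔ ∀ l : K.cycles j ⟶ G, ∃ b, K.iCycles j ≫ b = l := by
  have hS := cyclesSequence_shortExact hij hj
  have := hS.epi_g
  have : Epi (K.toCycles i j) := hS.epi_g
  rw [exactAt_homTo_iff rfl (c.next_eq' hij)]
  refine ⟨fun h l => ?_, fun h a ha => ?_⟩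
  · obtain ⟨b, hb⟩ := h (K.toCycles i j ≫ l) (by simp)
    exact ⟨b, by simp [← cancel_epi (K.toCycles i j), hb]⟩
  · have ha' : K.iCycles i ≫ a = 0 := (d_comp_eq_zero_iff rfl hi a).1 ha
    obtain ⟨b, hb⟩ := h (hS.exact.desc a ha')
    exact ⟨b, by rw [← K.toCycles_i, Category.assoc, hb]; exact hS.exact.g_desc a ha'⟩

theorem exactAt_homFrom_iff_cycles (hij : c.Rel i j) :
    (((homFrom c).obj (op G)).obj K).ExactAt j ↔
      ∀ l : G ⟶ K.cycles j, ∃ b, b ≫ K.toCycles i j = l := by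
  rw [exactAt_homFrom_iff (c.prev_eq' hij) rfl]
  refine ⟨fun h l => ?_, fun h a ha => ?_⟩
  · obtain ⟨b, hb⟩ := h (l ≫ K.iCycles j) (by simp)
    exact ⟨b, by simp [← cancel_mono (K.iCycles j), hb]⟩
  · obtain ⟨b, hb⟩ := h (K.liftCycles a _ rfl ha)
    exact ⟨b, by rw [← K.toCycles_i, ← Category.assoc, hb, K.liftCycles_i]⟩

end HomExactness

section ProperResolutionsOfFiniteLength

variable {C : Type u} [Category.{v} C] [Abelian C]

section Chain

variable [HasExt.{w} C] {L : ChainComplex C ℕ}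

theorem isGorensteinProjective_cycles (hL : L.Acyclic) {n : ℕ}
    (hG : IsGorensteinProjective (L.X n))
    (h : (((homTo _).obj (op L)).obj (L.cycles n)).ExactAt (n + 1)) :
    IsGorensteinProjective (L.cycles n) := by
  obtain ⟨r, hr⟩ := (exactAt_homTo_iff_cycles rfl (hL _) (hL n)).1 h (𝟙 _)
  exact .of_retract ⟨L.iCycles n, r, hr⟩ hG

theorem hasApproximation_cycles (hL : L.Acyclic) (hG : ∀ n, IsGorensteinProjective (L.X (n + 1)))
    {N : ℕ} (hN : ∀ W n, N ≤ n → (((homTo _).obj (op L)).obj W).ExactAt n) (n : ℕ) :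
    HasApproximation (L.cycles n) := by
  have step (n : ℕ) (h : HasApproximation (L.cycles (n + 1))) : HasApproximation (L.cycles n) :=
    .X₃ (cyclesSequence_shortExact rfl (hL n)) h (hG n)
  suffices ∀ m n, N ≤ n + m → HasApproximation (L.cycles n) from this N n (by lia)
  intro m
  induction m with
  | zero =>
    exact fun n hn => step n <| .of_isGorensteinProjective <|
      isGorensteinProjective_cycles hL (hG n) (hN _ _ (by lia))
  | succ m ih => exact fun n hn => step n (ih (n + 1) (by lia))

theorem homTo_acyclic_of_eventually_exactAt [EnoughProjectives C] (hL : L.Acyclic)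
    (hG : ∀ n, IsGorensteinProjective (L.X (n + 1)))
    (hproper : ∀ G, IsGorensteinProjective G → (((homFrom _).obj (op G)).obj L).Acyclic) {N : ℕ}
    (hN : ∀ W n, N ≤ n → (((homTo _).obj (op L)).obj W).ExactAt n) {R : C}
    (hR : IsInjectiveForFiniteProjectiveDimension R) :
    (((homTo _).obj (op L)).obj R).Acyclic := by
  rintro (_ | n)
  · refine (exactAt_homTo_iff rfl rfl).2 fun a ha => ⟨0, ?_⟩
    rw [d_comp_eq_zero_iff rfl (hL 0), Preadditive.IsIso.comp_left_eq_zero] at ha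
    rw [ha, comp_zero]
  · refine (exactAt_homTo_iff_cycles rfl (hL _) (hL n)).2 fun l => ?_
    cases n with
    | zero => exact ⟨inv (L.iCycles 0) ≫ l, by simp⟩
    | succ n =>
      exact (hasApproximation_cycles hL hG hN n).exists_comp_eq
        (cyclesSequence_shortExact rfl (hL n)) (hG n)
        (fun G hG a => (exactAt_homFrom_iff_cycles rfl).1 (hproper G hG n) a) hR l

end Chain

theorem homFrom_acyclic_of_eventually_exactAt [HasExt.{w} Cᵒᵖ] [EnoughInjectives C]
    {L : CochainComplex C ℕ} (hL : L.Acyclic)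
    (hG : ∀ n, IsGorensteinProjective (op (L.X (n + 1))))
    (hproper : ∀ G : C, IsGorensteinProjective (op G) → (((homTo _).obj (op L)).obj G).Acyclic)
    {N : ℕ} (hN : ∀ (W : C) n, N ≤ n → (((homFrom _).obj (op W)).obj L).ExactAt n) {R : C}
    (hR : IsInjectiveForFiniteProjectiveDimension (op R)) :
    (((homFrom _).obj (op R)).obj L).Acyclic := fun n =>
  exactAt_homTo_op_iff.1 <| homTo_acyclic_of_eventually_exactAt (L := L.op)
    (fun n => (hL n).op) hG
    (fun G hG n => exactAt_homFrom_op_iff.2 (hproper G.unop hG n))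
    (fun W n hn => exactAt_homTo_op_iff.2 (hN W.unop n hn)) hR n

end ProperResolutionsOfFiniteLength

section TotallyAcyclicComplexes

variable {C : Type u} [Category.{v} C] [Abelian C]

section Cycles

variable [HasExt.{w} C] {ι : Type*} {c : ComplexShape ι} {K : HomologicalComplex C c}

theorem isGorensteinProjective_cycles_of_totallyAcyclic (hnext : ∀ i, c.Rel i (c.next i))
    (hprev : ∀ i, c.Rel (c.prev i) i) (hP : ∀ i, Projective (K.X i)) (hK : K.Acyclic)
    (hQ : ∀ Q : C, Projective Q → (((homTo c).obj (op K)).obj Q).Acyclic) (i : ι) :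
    IsGorensteinProjective (K.cycles i) := by
  let T : ObjectProperty C := fun X => ∃ i, K.cycles i = X
  refine IsGorensteinProjective.coinduction (T := T) ?_ _ ⟨i, rfl⟩
  rintro _ ⟨i, rfl⟩
  refine ⟨fun Q _ n => ?_, _, _, _, _, _, cyclesSequence_shortExact (hnext i) (hK _), hP i, _, rfl⟩
  induction n generalizing i with
  | zero =>
    have : Subsingleton (Ext (cyclesSequence K (c.prev i) i).X₂ Q 1) :=
      Ext.subsingleton_of_projective (K.X (c.prev i)) Q 0
    refine subsingleton_ext_one_X₃ (cyclesSequence_shortExact (hprev i) (hK i)) ?_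
    exact (exactAt_homTo_iff_cycles (hprev _) (hK _) (hK _)).1 (hQ Q inferInstance _)
  | succ n ih =>
    have : Subsingleton (Ext (cyclesSequence K (c.prev i) i).X₁ Q (n + 1)) := ih (c.prev i)
    have : Subsingleton (Ext (cyclesSequence K (c.prev i) i).X₂ Q (n + 1 + 1)) :=
      Ext.subsingleton_of_projective (K.X (c.prev i)) Q (n + 1)
    exact subsingleton_ext_X₃ (cyclesSequence_shortExact (hprev i) (hK i)) _

theorem homTo_acyclic_of_isGorensteinProjective_cycles (hnext : ∀ i, c.Rel i (c.next i))
    (hK : K.Acyclic) (hG : ∀ i, IsGorensteinProjective (K.cycles i)) (Q : C) [Projective Q] :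
    (((homTo c).obj (op K)).obj Q).Acyclic := fun i =>
  (exactAt_homTo_iff_cycles (hnext i) (hK _) (hK _)).2 fun l =>
    exists_f_comp_eq (cyclesSequence_shortExact (hnext _) (hK _))
      (hW := (hG _).subsingleton_ext Q 0) l

end Cycles

theorem homFrom_acyclic_of_isGorensteinProjective_op_cycles [HasExt.{w} Cᵒᵖ] {ι : Type*}
    {c : ComplexShape ι} {K : HomologicalComplex C c} (hprev : ∀ i, c.Rel (c.prev i) i)
    (hK : K.Acyclic) (hG : ∀ i, IsGorensteinProjective (op (K.cycles i))) (J : C) [Injective J] :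
    (((homFrom c).obj (op J)).obj K).Acyclic := fun i =>
  (exactAt_homFrom_iff_cycles (hprev i)).2 fun l =>
    let ⟨b, hb⟩ := exists_f_comp_eq (cyclesSequence_shortExact (hprev i) (hK i)).op
      (hW := (hG (c.prev i)).subsingleton_ext (op J) 0) l.op
    ⟨b.unop, congrArg Quiver.Hom.unop hb⟩

theorem nonempty_image_iso_cycles {ι : Type*}
    {c : ComplexShape ι} {K : HomologicalComplex C c} {i j : ι} (hij : c.Rel i j)
    (hK : K.ExactAt j) : Nonempty (image (K.d i j) ≅ K.cycles j) := by
  have := epi_toCycles (c.prev_eq' hij) hK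
  have := strongEpi_of_epi (K.toCycles i j)
  exact ⟨(image.isoStrongEpiMono (K.toCycles i j) (K.iCycles j) (K.toCycles_i _ _)).symm⟩

/-- `X` is a syzygy of `Y` relative to the class `Q`: there is a short exact sequence
`0 ⟶ X ⟶ P ⟶ Y ⟶ 0` with `P` in `Q`. -/
def IsSyzygy (Q : ObjectProperty C) (X Y : C) : Prop :=
  ∃ (P : C) (i : X ⟶ P) (p : P ⟶ Y) (w : i ≫ p = 0), (ShortComplex.mk i p w).ShortExact ∧ Q P

theorem exists_int_chain {T : Type*} {r : T → T → Prop} (hr : ∀ x, ∃ y, r x y)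
    (hl : ∀ x, ∃ y, r y x) (x : T) : ∃ F : ℤ → T, F 0 = x ∧ ∀ n, r (F n) (F (n + 1)) := by
  choose right hr using hr
  choose left hl using hl
  refine ⟨fun n => match n with
    | .ofNat n => n.rec x fun _ => right
    | .negSucc n => (n + 1).rec x fun _ => left, rfl, fun n => ?_⟩
  match n with
  | .ofNat n => exact hr _
  | .negSucc 0 => exact hl x
  | .negSucc (n + 1) => exact hl _

theorem exists_acyclic_of_isSyzygy {Q : ObjectProperty C} (Z : ℤ → C)
    (hZ : ∀ n, IsSyzygy Q (Z n) (Z (n + 1))) :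
    ∃ K : CochainComplex C ℤ, K.Acyclic ∧ (∀ n, Q (K.X n)) ∧ ∀ n, Nonempty (K.cycles n ≅ Z n) := by
  choose P f g w hS hP using hZ
  have hf n : Mono (f n) := (hS n).mono_f
  have hg n : Epi (g n) := (hS n).epi_g
  let K : CochainComplex C ℤ := CochainComplex.of P (fun n => g n ≫ f (n + 1)) fun n => by
    rw [Category.assoc, reassoc_of% w (n + 1), zero_comp, comp_zero]
  have hd n : K.d n (n + 1) = g n ≫ f (n + 1) :=
    CochainComplex.of_d P (fun n => g n ≫ f (n + 1)) n
  have hfd n : f n ≫ K.d n (n + 1) = 0 := by rw [hd, reassoc_of% w n, zero_comp]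
  have hlift n {T : C} (k : T ⟶ K.X n) (hk : k ≫ K.d n (n + 1) = 0) : k ≫ g n = 0 := by
    rw [← cancel_mono (f (n + 1)), Category.assoc, ← hd, hk, zero_comp]
  have hker n : IsLimit (KernelFork.ofι (f n) (hfd n)) := KernelFork.IsLimit.ofι' _ _ fun k hk =>
    ⟨(hS n).exact.lift k (hlift n k hk), (hS n).exact.lift_f _ _⟩
  refine ⟨K, fun n => ?_, hP, fun n =>
    ⟨(K.cyclesIsKernel n (n + 1) (by simp)).conePointUniqueUpToIso (hker n)⟩⟩
  obtain ⟨n, rfl⟩ : ∃ m, n = m + 1 := ⟨n - 1, by lia⟩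
  rw [K.exactAt_iff_exact_up_to_refinements n (n + 1) (n + 1 + 1) (by simp) (by simp)]
  intro A x hx
  obtain ⟨A', π, hπ, y, hy⟩ :=
    surjective_up_to_refinements_of_epi (g n) ((hS (n + 1)).exact.lift x (hlift _ x hx))
  refine ⟨A', π, hπ, y, ?_⟩
  rw [hd, ← reassoc_of% hy]
  exact congrArg (π ≫ ·) ((hS (n + 1)).exact.lift_f x (hlift _ x hx)).symm

theorem exists_acyclic_of_exists_isSyzygy {T Q : ObjectProperty C}
    (hr : ∀ X, T X → ∃ Y, T Y ∧ IsSyzygy Q X Y) (hl : ∀ X, T X → ∃ Y, T Y ∧ IsSyzygy Q Y X)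
    {X : C} (hX : T X) :
    ∃ K : CochainComplex C ℤ, K.Acyclic ∧ (∀ n, Q (K.X n)) ∧ (∀ n, T.isoClosure (K.cycles n)) ∧
      Nonempty (K.cycles 0 ≅ X) := by
  obtain ⟨F, hF₀, hF⟩ := exists_int_chain (T := {X // T X}) (r := fun X Y => IsSyzygy Q X.1 Y.1)
    (fun X => let ⟨Y, hY, h⟩ := hr X X.2; ⟨⟨Y, hY⟩, h⟩)
    (fun X => let ⟨Y, hY, h⟩ := hl X X.2; ⟨⟨Y, hY⟩, h⟩) ⟨X, hX⟩
  obtain ⟨K, hK, hQ, hZ⟩ := exists_acyclic_of_isSyzygy (fun n => (F n).1) hF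
  exact ⟨K, hK, hQ, fun n => ⟨_, (F n).2, hZ n⟩, by simpa only [hF₀] using hZ 0⟩

namespace IsGorensteinProjective

variable {X : C}

theorem exists_isSyzygy_cosyzygy [HasExt.{w} C] (hX : IsGorensteinProjective X) :
    ∃ Y, IsGorensteinProjective Y ∧ IsSyzygy (isProjective C) X Y := by
  obtain ⟨P, Y, i, p, w, hS, hP, hY⟩ := hX.exists_shortExact
  exact ⟨Y, hY, P, i, p, w, hS, hP⟩

theorem exists_isSyzygy_syzygy [HasExt.{w} C] [EnoughProjectives C]
    (hX : IsGorensteinProjective X) :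
    ∃ Y, IsGorensteinProjective Y ∧ IsSyzygy (isProjective C) Y X := by
  let S : ShortComplex C := ShortComplex.mk _ _ (kernel.condition (Projective.π X))
  have hS : S.ShortExact := .mk (ShortComplex.exact_kernel _)
  have hP : Projective S.X₂ := Projective.projective_over X
  exact ⟨S.X₁, .X₁_of_projective hS hX, S.X₂, S.f, S.g, S.zero, hS, hP⟩

theorem exists_isSyzygy_syzygy_unop [HasExt.{w} Cᵒᵖ] (hX : IsGorensteinProjective (op X)) :
    ∃ Y : C, IsGorensteinProjective (op Y) ∧ IsSyzygy (isInjective C) Y X := by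
  obtain ⟨P, Y, i, p, w, hS, hP, hY⟩ := hX.exists_shortExact
  exact ⟨Y.unop, hY, P.unop, p.unop, i.unop, congrArg Quiver.Hom.unop w, hS.unop,
    inferInstanceAs (Injective P.unop)⟩

theorem exists_isSyzygy_cosyzygy_unop [HasExt.{w} Cᵒᵖ] [EnoughInjectives C]
    (hX : IsGorensteinProjective (op X)) :
    ∃ Y : C, IsGorensteinProjective (op Y) ∧ IsSyzygy (isInjective C) X Y := by
  let S : ShortComplex C := ShortComplex.mk _ _ (cokernel.condition (Injective.ι X))
  have hS : S.ShortExact := .mk (ShortComplex.exact_cokernel _)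
  have hI : Injective S.X₂ := Injective.injective_under X
  have : Projective S.op.X₂ := inferInstanceAs (Projective (op S.X₂))
  exact ⟨S.X₃, .X₁_of_projective hS.op hX, S.X₂, S.f, S.g, S.zero, hS, hI⟩

end IsGorensteinProjective

end TotallyAcyclicComplexes

section GorensteinModules

variable {A : Type u} [Ring A]

instance : HasExt.{u} (ModuleCat.{u} A)ᵒᵖ := hasExt_of_enoughProjectives _

theorem gorensteinProjective_iff {M : ModuleCat.{u} A} :
    GorensteinProjective A M ↔ IsGorensteinProjective M := by
  refine ⟨fun ⟨P, hP, hac, hQ, ⟨e⟩⟩ => ?_, fun hM => ?_⟩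
  · exact (isGorensteinProjective_cycles_of_totallyAcyclic (by simp) (by simp) hP hac hQ 0).of_iso e
  · obtain ⟨K, hK, hP, hG, e⟩ := exists_acyclic_of_exists_isSyzygy
      (fun X hX => hX.exists_isSyzygy_cosyzygy) (fun X hX => hX.exists_isSyzygy_syzygy) hM
    exact ⟨K, hP, hK, fun Q _ => homTo_acyclic_of_isGorensteinProjective_cycles (by simp) hK
      (fun n => let ⟨_, hY, ⟨e⟩⟩ := hG n; hY.of_iso e.symm) Q, e⟩

theorem gorensteinInjective_iff {N : ModuleCat.{u} A} :
    GorensteinInjective A N ↔ IsGorensteinProjective (op N) := by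
  refine ⟨fun ⟨I, hI, hac, hJ, ⟨e⟩⟩ => ?_, fun hN => ?_⟩
  · have hG := isGorensteinProjective_cycles_of_totallyAcyclic (K := I.op)
      (fun i => show (ComplexShape.up ℤ).Rel ((ComplexShape.up ℤ).prev i) i by simp)
      (fun i => show (ComplexShape.up ℤ).Rel i ((ComplexShape.up ℤ).next i) by simp)
      (fun i => inferInstanceAs (Projective (op (I.X i)))) (fun i => (hac i).op)
      (fun Q _ i => exactAt_homTo_op_iff.2 (hJ Q.unop inferInstance i)) (-1)
    obtain ⟨e'⟩ := nonempty_image_iso_cycles (K := I.op) (i := 0) (j := -1) (by simp) (hac _).op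
    exact hG.of_iso (e'.symm ≪≫ (imageOpOp _).symm ≪≫ e.symm.op)
  · obtain ⟨K, hK, hI, hG, ⟨e⟩⟩ := exists_acyclic_of_exists_isSyzygy
      (T := fun N => IsGorensteinProjective (op N))
      (fun X hX => hX.exists_isSyzygy_cosyzygy_unop) (fun X hX => hX.exists_isSyzygy_syzygy_unop) hN
    obtain ⟨e'⟩ := nonempty_image_iso_cycles (i := -1) (j := 0) (by simp) (hK 0)
    exact ⟨K, hI, hK, fun J _ => homFrom_acyclic_of_isGorensteinProjective_op_cycles (by simp) hK
      (fun n => let ⟨_, hY, ⟨e⟩⟩ := hG n; hY.of_iso e.op) J, ⟨e' ≪≫ e⟩⟩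

end GorensteinModules

section Zigzags

variable {C : Type u} [Category.{v} C] [Preadditive C]

/-- The zigzags of degree `n` in the bicomplex `Hom(L, K)`: the families of morphisms
`L.X p ⟶ K.X q` such that, whenever `p + q = n`, the components in bidegrees `(p + 1, q)` and
`(p, q + 1)` have the same image in bidegree `(p + 1, q + 1)`. Only the components of total degree
`n + 1` are constrained. -/
def zigzags (L : ChainComplex C ℕ) (K : CochainComplex C ℕ) (n : ℕ) :
    AddSubgroup (∀ p q, L.X p ⟶ K.X q) where
  carrier := {w | ∀ p q, p + q = n → w (p + 1) q ≫ K.d q (q + 1) = L.d (p + 1) p ≫ w p (q + 1)}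
  zero_mem' _ _ _ := by simp
  add_mem' hw hw' p q hpq := by simp [hw p q hpq, hw' p q hpq]
  neg_mem' hw p q hpq := by simp [hw p q hpq]

/-- The pairs of end components of the zigzags of degree `n`. When `L` and `K` are a resolution and
a coresolution augmented to their degree `0`, these are the correspondences between the cocycles
computing the extension groups of degree `n`. -/
def zigzagEnds (L : ChainComplex C ℕ) (K : CochainComplex C ℕ) (n : ℕ) :
    AddSubgroup ((L.X (n + 1) ⟶ K.X 0) × (L.X 0 ⟶ K.X (n + 1))) where
  carrier := {x | ∃ w ∈ zigzags L K n, w (n + 1) 0 = x.1 ∧ w 0 (n + 1) = x.2}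
  zero_mem' := ⟨0, zero_mem _, rfl, rfl⟩
  add_mem' := by
    rintro x y ⟨w, hw, hx, hx'⟩ ⟨w', hw', hy, hy'⟩
    exact ⟨w + w', add_mem hw hw', congrArg₂ _ hx hy, congrArg₂ _ hx' hy'⟩
  neg_mem' := by
    rintro x ⟨w, hw, hx, hx'⟩
    exact ⟨-w, neg_mem hw, congrArg _ hx, congrArg _ hx'⟩

variable {L L' : ChainComplex C ℕ} {K K' : CochainComplex C ℕ} {n : ℕ}

theorem op_mem_zigzags {w : ∀ p q, L.X p ⟶ K.X q} (hw : w ∈ zigzags L K n) :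
    (fun q p => (w p q).op) ∈ zigzags (C := Cᵒᵖ) K.op L.op n := fun q p h =>
  congrArg Quiver.Hom.op (hw p q (by lia)).symm

theorem unop_mem_zigzags {w : ∀ q p, (op (K.X q) : Cᵒᵖ) ⟶ op (L.X p)}
    (hw : w ∈ zigzags (C := Cᵒᵖ) K.op L.op n) : (fun p q => (w q p).unop) ∈ zigzags L K n :=
  fun p q h => congrArg Quiver.Hom.unop (hw q p (by lia)).symm

theorem op_mem_zigzagEnds_iff {b : L.X (n + 1) ⟶ K.X 0} {c : L.X 0 ⟶ K.X (n + 1)} :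
    (c.op, b.op) ∈ zigzagEnds (C := Cᵒᵖ) K.op L.op n ↔ (b, c) ∈ zigzagEnds L K n := by
  constructor
  · rintro ⟨w, hw, hc, hb⟩
    exact ⟨_, unop_mem_zigzags hw, congrArg Quiver.Hom.unop hb, congrArg Quiver.Hom.unop hc⟩
  · rintro ⟨w, hw, hb, hc⟩
    exact ⟨_, op_mem_zigzags hw, congrArg Quiver.Hom.op hc, congrArg Quiver.Hom.op hb⟩

theorem comp_mem_zigzagEnds {b : L.X (n + 1) ⟶ K.X 0} {c : L.X 0 ⟶ K.X (n + 1)}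
    (h : (b, c) ∈ zigzagEnds L K n) (f : L' ⟶ L) (g : K ⟶ K') :
    (f.f (n + 1) ≫ b ≫ g.f 0, f.f 0 ≫ c ≫ g.f (n + 1)) ∈ zigzagEnds L' K' n := by
  obtain ⟨w, hw, rfl, rfl⟩ := h
  refine ⟨fun p q => f.f p ≫ w p q ≫ g.f q, fun p q hpq => ?_, rfl, rfl⟩
  simp [reassoc_of% hw p q hpq]

theorem eq_zero_of_d_one_zero_comp {G : C} (h : (((homTo _).obj (op L)).obj G).ExactAt 0)
    {a : L.X 0 ⟶ G} (ha : L.d 1 0 ≫ a = 0) : a = 0 := by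
  obtain ⟨b, rfl⟩ := (exactAt_homTo_iff (by simp) rfl).1 h a ha
  rw [L.shape 0 _ (by simp), zero_comp]

variable (hLK : ∀ q, (((homTo _).obj (op L)).obj (K.X (q + 1))).Acyclic)

include hLK

theorem exists_zigzag {p q : ℕ} (hpq : p + q = n + 1) (b : L.X p ⟶ K.X q)
    (hb : L.d (p + 1) p ≫ b ≫ K.d q (q + 1) = 0) :
    ∃ w : ∀ p q, L.X p ⟶ K.X q, w p q = b ∧ ∀ i j, i + j = n → i < p →
      w (i + 1) j ≫ K.d j (j + 1) = L.d (i + 1) i ≫ w i (j + 1) := by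
  induction p generalizing q with
  | zero => exact ⟨Function.update 0 0 (Function.update 0 q b), by simp, by simp⟩
  | succ p ih =>
    obtain ⟨b', hb'⟩ := exists_ext_of_acyclic (hLK q) (i := p + 2) (k := p) (by simp) (by simp)
      (b ≫ K.d q (q + 1)) hb
    obtain ⟨w, rfl, hw⟩ := ih (by lia) b' (by rw [reassoc_of% hb']; simp)
    refine ⟨Function.update w (p + 1) (Function.update (w (p + 1)) q b), by simp,
      fun i j hij hi => ?_⟩
    obtain rfl | hi := (Nat.lt_succ_iff_lt_or_eq.1 hi).symm
    · obtain rfl : j = q := by lia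
      simp [hb']
    · rw [Function.update_of_ne (by lia), Function.update_of_ne (by lia)]
      exact hw i j hij hi

theorem exists_right_mem_zigzagEnds (b : L.X (n + 1) ⟶ K.X 0) (hb : L.d (n + 2) (n + 1) ≫ b = 0) :
    ∃ c, c ≫ K.d (n + 1) (n + 2) = 0 ∧ (b, c) ∈ zigzagEnds L K n := by
  obtain ⟨w, rfl, hw⟩ := exists_zigzag (n := n) (q := 0) hLK rfl b
    (by rw [reassoc_of% hb, zero_comp])
  refine ⟨w 0 (n + 1), eq_zero_of_d_one_zero_comp (hLK _ _) ?_, w,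
    fun p q hpq => hw p q hpq (by lia), rfl, rfl⟩
  rw [← reassoc_of% hw 0 n (by lia) (by lia), K.d_comp_d, comp_zero]

theorem exists_comp_d_eq_of_mem_zigzags {w : ∀ p q, L.X p ⟶ K.X q} (hw : w ∈ zigzags L K n)
    {p q : ℕ} (hpq : p + q = n) (v : L.X p ⟶ K.X q)
    (hv : L.d (p + 1) p ≫ (w p (q + 1) - v ≫ K.d q (q + 1)) = 0) :
    ∃ c : L.X 0 ⟶ K.X n, c ≫ K.d n (n + 1) = w 0 (n + 1) := by
  induction p generalizing q with
  | zero =>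
    obtain rfl : q = n := by lia
    exact ⟨v, (sub_eq_zero.1 (eq_zero_of_d_one_zero_comp (hLK q 0) hv)).symm⟩
  | succ p ih =>
    obtain ⟨v', hv'⟩ := exists_ext_of_acyclic (hLK q) (i := p + 2) (k := p) (by simp) (by simp) _ hv
    refine ih (by lia) v' ?_
    rw [Preadditive.comp_sub, reassoc_of% hv', ← hw p (q + 1) (by lia)]
    simp

theorem exists_comp_d_eq_of_mem_zigzagEnds {b₀ : L.X n ⟶ K.X 0}
    {c : L.X 0 ⟶ K.X (n + 1)} (h : (L.d (n + 1) n ≫ b₀, c) ∈ zigzagEnds L K n) :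
    ∃ c₀, c₀ ≫ K.d n (n + 1) = c := by
  obtain ⟨w, hw, hb₀, rfl⟩ := h
  refine exists_comp_d_eq_of_mem_zigzags hLK hw (q := 0) rfl b₀ ?_
  rw [Preadditive.comp_sub, ← hw n 0 rfl, hb₀, Category.assoc, sub_self]

theorem eq_zero_of_zero_mem_zigzagEnds {c : L.X 0 ⟶ K.X 1} (h : (0, c) ∈ zigzagEnds L K 0) :
    c = 0 := by
  obtain ⟨w, hw, h, rfl⟩ := h
  refine eq_zero_of_d_one_zero_comp (hLK 0 0) ?_
  rw [← hw 0 0 rfl, show w 1 0 = 0 from h, zero_comp]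

omit hLK

variable (hKL : ∀ p, (((homFrom _).obj (op (L.X (p + 1)))).obj K).Acyclic)

include hKL

theorem exists_left_mem_zigzagEnds (c : L.X 0 ⟶ K.X (n + 1)) (hc : c ≫ K.d (n + 1) (n + 2) = 0) :
    ∃ b, L.d (n + 2) (n + 1) ≫ b = 0 ∧ (b, c) ∈ zigzagEnds L K n := by
  obtain ⟨b, hb, h⟩ := exists_right_mem_zigzagEnds (L := K.op) (K := L.op)
    (fun p i => exactAt_homTo_op_iff.2 (hKL p i)) c.op (congrArg Quiver.Hom.op hc)
  exact ⟨b.unop, congrArg Quiver.Hom.unop hb, op_mem_zigzagEnds_iff.1 h⟩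

include hLK

theorem exists_d_comp_eq_iff_of_mem_zigzagEnds {b : L.X (n + 1) ⟶ K.X 0} {c : L.X 0 ⟶ K.X (n + 1)}
    (h : (b, c) ∈ zigzagEnds L K n) :
    (∃ b₀, L.d (n + 1) n ≫ b₀ = b) ↔ ∃ c₀, c₀ ≫ K.d n (n + 1) = c := by
  constructor
  · rintro ⟨b₀, rfl⟩
    exact exists_comp_d_eq_of_mem_zigzagEnds hLK h
  · rintro ⟨c₀, rfl⟩
    obtain ⟨b₀, hb₀⟩ := exists_comp_d_eq_of_mem_zigzagEnds (L := K.op) (K := L.op) (b₀ := c₀.op)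
      (fun p i => exactAt_homTo_op_iff.2 (hKL p i)) (op_mem_zigzagEnds_iff.2 h)
    exact ⟨b₀.unop, congrArg Quiver.Hom.unop hb₀⟩

theorem eq_zero_iff_of_mem_zigzagEnds {b : L.X 1 ⟶ K.X 0} {c : L.X 0 ⟶ K.X 1}
    (h : (b, c) ∈ zigzagEnds L K 0) : b = 0 ↔ c = 0 := by
  constructor
  · rintro rfl
    exact eq_zero_of_zero_mem_zigzagEnds hLK h
  · rintro rfl
    exact congrArg Quiver.Hom.unop <| eq_zero_of_zero_mem_zigzagEnds (L := K.op) (K := L.op)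
      (fun p i => exactAt_homTo_op_iff.2 (hKL p i)) (op_mem_zigzagEnds_iff.2 h)

end Zigzags

section HomologyRelation

variable {ι κ : Type*} {c : ComplexShape ι} {d : ComplexShape κ}
  {E E' : HomologicalComplex AddCommGrpCat.{v} c} {F F' : HomologicalComplex AddCommGrpCat.{v} d}
  {i : ι} {j : κ}

/-- The relation on homology classes induced by an additive relation between chains: two classes
are related if they have related representatives. -/
noncomputable def homologyRel (I : AddSubgroup (E.X i × F.X j)) :
    AddSubgroup (E.homology i × F.homology j) :=
  (I.comap ((E.iCycles i).hom.prodMap (F.iCycles j).hom)).map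
    ((E.homologyπ i).hom.prodMap (F.homologyπ j).hom)

theorem homologyπ_surjective : Function.Surjective (E.homologyπ i) :=
  (AddCommGrpCat.epi_iff_surjective _).1 inferInstance

theorem exists_iCycles_eq (x : E.X i) (hx : E.d i (c.next i) x = 0) :
    ∃ z : E.cycles i, E.iCycles i z = x := by
  have h := ShortComplex.exact_of_f_is_kernel
    (ShortComplex.mk _ _ (E.iCycles_d i (c.next i))) (E.cyclesIsKernel _ _ rfl)
  rw [ShortComplex.ab_exact_iff] at h
  exact h x hx

theorem d_iCycles_apply (z : E.cycles i) : E.d i (c.next i) (E.iCycles i z) = 0 :=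
  ConcreteCategory.congr_hom (E.iCycles_d i (c.next i)) z

theorem homologyπ_eq_zero_iff (z : E.cycles i) :
    E.homologyπ i z = 0 ↔ ∃ y, E.d (c.prev i) i y = E.iCycles i z := by
  have hi := (AddCommGrpCat.mono_iff_injective (E.iCycles i)).1 inferInstance
  have hd (y) : E.iCycles i (E.toCycles (c.prev i) i y) = E.d (c.prev i) i y :=
    ConcreteCategory.congr_hom (E.toCycles_i _ _) y
  have h := ShortComplex.exact_of_g_is_cokernel
    (ShortComplex.mk _ _ (E.toCycles_comp_homologyπ (c.prev i) i)) (E.homologyIsCokernel _ i rfl)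
  simp_rw [← hd, hi.eq_iff]
  exact (ShortComplex.ab_exact_iff_function_exact _).1 h z

theorem exists_iso_homologyRel_iff (I : AddSubgroup (E.X i × F.X j))
    (hE : ∀ x, E.d i (c.next i) x = 0 → ∃ y, F.d j (d.next j) y = 0 ∧ (x, y) ∈ I)
    (hF : ∀ y, F.d j (d.next j) y = 0 → ∃ x, E.d i (c.next i) x = 0 ∧ (x, y) ∈ I)
    (hI : ∀ x y, (x, y) ∈ I →
      ((∃ x₀, E.d (c.prev i) i x₀ = x) ↔ ∃ y₀, F.d (d.prev j) j y₀ = y)) :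
    ∃ e : E.homology i ≅ F.homology j, ∀ x y, (x, y) ∈ homologyRel I ↔ e.hom x = y := by
  obtain ⟨e, he⟩ := AddMonoidHom.exists_addEquiv_range_eq_graph
    (f := ((E.homologyπ i).hom.prodMap (F.homologyπ j).hom).comp
      (I.comap ((E.iCycles i).hom.prodMap (F.iCycles j).hom)).subtype)
    (fun x => by
      obtain ⟨z, rfl⟩ := homologyπ_surjective x
      obtain ⟨y, hy, h⟩ := hE _ (d_iCycles_apply z)
      obtain ⟨w, rfl⟩ := exists_iCycles_eq y hy
      exact ⟨⟨(z, w), h⟩, rfl⟩)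
    (fun y => by
      obtain ⟨w, rfl⟩ := homologyπ_surjective y
      obtain ⟨x, hx, h⟩ := hF _ (d_iCycles_apply w)
      obtain ⟨z, rfl⟩ := exists_iCycles_eq x hx
      exact ⟨⟨(z, w), h⟩, rfl⟩)
    (fun g g' => by
      have := (homologyπ_eq_zero_iff _).trans
        ((hI _ _ (g - g').2).trans (homologyπ_eq_zero_iff _).symm)
      simpa [sub_eq_zero] using this)
  rw [AddMonoidHom.range_comp, AddSubgroup.range_subtype] at he
  exact ⟨e.toAddCommGrpIso, fun x y => SetLike.ext_iff.1 he (x, y)⟩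

theorem homologyMap_mem_homologyRel {I : AddSubgroup (E.X i × F.X j)}
    {I' : AddSubgroup (E'.X i × F'.X j)} (φ : E ⟶ E') (ψ : F ⟶ F')
    (hI : ∀ x y, (x, y) ∈ I → (φ.f i x, ψ.f j y) ∈ I') {x : E.homology i} {y : F.homology j}
    (h : (x, y) ∈ homologyRel I) :
    (HomologicalComplex.homologyMap φ i x, HomologicalComplex.homologyMap ψ j y) ∈
      homologyRel I' := by
  obtain ⟨⟨z, w⟩, hzw, h⟩ := h
  obtain ⟨rfl, rfl⟩ := Prod.mk.inj h
  have hi := ConcreteCategory.congr_hom (HomologicalComplex.cyclesMap_i φ i) z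
  have hj := ConcreteCategory.congr_hom (HomologicalComplex.cyclesMap_i ψ j) w
  refine ⟨(HomologicalComplex.cyclesMap φ i z, HomologicalComplex.cyclesMap ψ j w), ?_,
    Prod.ext (ConcreteCategory.congr_hom (HomologicalComplex.homologyπ_naturality φ i) z).symm
      (ConcreteCategory.congr_hom (HomologicalComplex.homologyπ_naturality ψ j) w).symm⟩
  exact (congrArg (· ∈ I') (Prod.ext hi hj)).mpr (hI _ _ hzw)

end HomologyRelation

section Augment

variable {C : Type u} [Category.{v} C] [Preadditive C] {M M' : C}

/-- The map of augmented chain complexes induced by a chain map over a morphism. -/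
def chainAugmentMap {K K' : ChainComplex C ℕ} {π : K.X 0 ⟶ M} {π' : K'.X 0 ⟶ M'}
    (h : K.d 1 0 ≫ π = 0) (h' : K'.d 1 0 ≫ π' = 0) (φ : K ⟶ K') (f : M ⟶ M')
    (hφ : φ.f 0 ≫ π' = π ≫ f) : K.augment π h ⟶ K'.augment π' h' where
  f
    | 0 => f
    | n + 1 => φ.f n
  comm' := by
    rintro i (_ | j) rfl
    · exact hφ
    · exact φ.comm (j + 1) j

/-- The map of augmented cochain complexes induced by a cochain map over a morphism. -/
def cochainAugmentMap {K K' : CochainComplex C ℕ} {η : M ⟶ K.X 0} {η' : M' ⟶ K'.X 0}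
    (h : η ≫ K.d 0 1 = 0) (h' : η' ≫ K'.d 0 1 = 0) (φ : K ⟶ K') (f : M ⟶ M')
    (hφ : η ≫ φ.f 0 = f ≫ η') : K.augment η h ⟶ K'.augment η' h' where
  f
    | 0 => f
    | n + 1 => φ.f n
  comm' := by
    rintro (_ | i) j rfl
    · exact hφ.symm
    · exact φ.comm i (i + 1)

end Augment

section Balance

variable {C : Type u} [Category.{v} C] [Abelian C] {X Y : ObjectProperty C} {M M' N N' : C}

/-- The augmented complex `⋯ ⟶ G₁ ⟶ G₀ ⟶ M` of a proper resolution, with `M` in degree `0`. -/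
abbrev ProperResolution.augmented (P : ProperResolution X M) : ChainComplex C ℕ :=
  P.complex.augment P.π P.d_π

/-- The augmented complex `N ⟶ R⁰ ⟶ R¹ ⟶ ⋯` of a proper coresolution, with `N` in degree `0`. -/
abbrev ProperCoresolution.augmented (Q : ProperCoresolution Y N) : CochainComplex C ℕ :=
  Q.complex.augment Q.η Q.η_d

/-- The relation between `Hⁿ(Hom(G, N))` and `Hⁿ(Hom(M, R))`, for resolutions `G` of `M` and `R` of
`N`, given by the zigzags in `Hom(G, R)`. -/
noncomputable def balanceRel (P : ProperResolution X M) (Q : ProperCoresolution Y N) (n : ℕ) :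
    AddSubgroup ((((homTo _).obj (op P.complex)).obj N).homology n ×
      (((homFrom _).obj (op M)).obj Q.complex).homology n) :=
  homologyRel (E := ((homTo _).obj (op P.complex)).obj N)
    (F := ((homFrom _).obj (op M)).obj Q.complex) (zigzagEnds P.augmented Q.augmented n)

variable {P : ProperResolution X M} {P' : ProperResolution X M'} {Q : ProperCoresolution Y N}
  {Q' : ProperCoresolution Y N'} {n : ℕ}

theorem exists_iso_balanceRel_iff
    (hP : ∀ q, (((homTo _).obj (op P.augmented)).obj (Q.complex.X q)).Acyclic)
    (hQ : ∀ p, (((homFrom _).obj (op (P.complex.X p))).obj Q.augmented).Acyclic) (n : ℕ) :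
    ∃ e : (((homTo _).obj (op P.complex)).obj N).homology n ≅
        (((homFrom _).obj (op M)).obj Q.complex).homology n,
      ∀ x y, (x, y) ∈ balanceRel P Q n ↔ e.hom x = y := by
  refine exists_iso_homologyRel_iff _ (fun b hb => ?_) (fun c hc => ?_) fun b c h => ?_
  · change P.complex.d ((ComplexShape.down ℕ).prev n) n ≫ b = 0 at hb
    change ∃ c : M ⟶ Q.complex.X n, c ≫ Q.complex.d n ((ComplexShape.up ℕ).next n) = 0 ∧ _
    rw [ChainComplex.prev] at hb
    rw [CochainComplex.next]
    exact exists_right_mem_zigzagEnds (L := P.augmented) (K := Q.augmented) hP b hb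
  · change c ≫ Q.complex.d n ((ComplexShape.up ℕ).next n) = 0 at hc
    change ∃ b : P.complex.X n ⟶ N, P.complex.d ((ComplexShape.down ℕ).prev n) n ≫ b = 0 ∧ _
    rw [CochainComplex.next] at hc
    rw [ChainComplex.prev]
    exact exists_left_mem_zigzagEnds (L := P.augmented) (K := Q.augmented) hQ c hc
  · change (∃ b₀ : P.complex.X ((ComplexShape.down ℕ).next n) ⟶ N,
        P.complex.d n ((ComplexShape.down ℕ).next n) ≫ b₀ = b) ↔
      ∃ c₀ : M ⟶ Q.complex.X ((ComplexShape.up ℕ).prev n),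
        c₀ ≫ Q.complex.d ((ComplexShape.up ℕ).prev n) n = c
    cases n with
    | zero =>
      rw [P.complex.shape _ _ (by simp), Q.complex.shape _ _ (by simp)]
      simp only [zero_comp, comp_zero, exists_const]
      exact eq_comm.trans ((eq_zero_iff_of_mem_zigzagEnds hP hQ h).trans eq_comm)
    | succ n =>
      rw [ChainComplex.next_nat_succ, CochainComplex.prev_nat_succ]
      exact exists_d_comp_eq_iff_of_mem_zigzagEnds hP hQ h

theorem homologyMap_mem_balanceRel_left {φ : P'.complex ⟶ P.complex} {f : M' ⟶ M}
    (hφ : φ.f 0 ≫ P.π = P'.π ≫ f) {x : (((homTo _).obj (op P.complex)).obj N).homology n}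
    {y : (((homFrom _).obj (op M)).obj Q.complex).homology n} (h : (x, y) ∈ balanceRel P Q n) :
    (HomologicalComplex.homologyMap (((homTo _).map φ.op).app N) n x,
      HomologicalComplex.homologyMap (((homFrom _).map f.op).app Q.complex) n y) ∈
        balanceRel P' Q n := by
  refine homologyMap_mem_homologyRel _ _ (fun (b : P.augmented.X (n + 1) ⟶ Q.augmented.X 0)
    (c : P.augmented.X 0 ⟶ Q.augmented.X (n + 1)) hbc => ?_) h
  have := comp_mem_zigzagEnds hbc (chainAugmentMap P'.d_π P.d_π φ f hφ) (𝟙 _)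
  simp only [HomologicalComplex.id_f, Category.comp_id] at this
  exact this

theorem homologyMap_mem_balanceRel_right {ψ : Q.complex ⟶ Q'.complex} {g : N ⟶ N'}
    (hψ : Q.η ≫ ψ.f 0 = g ≫ Q'.η) {x : (((homTo _).obj (op P.complex)).obj N).homology n}
    {y : (((homFrom _).obj (op M)).obj Q.complex).homology n} (h : (x, y) ∈ balanceRel P Q n) :
    (HomologicalComplex.homologyMap (((homTo _).obj (op P.complex)).map g) n x,
      HomologicalComplex.homologyMap (((homFrom _).obj (op M)).map ψ) n y) ∈
        balanceRel P Q' n := by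
  refine homologyMap_mem_homologyRel _ _ (fun b c hbc => ?_) h
  have := comp_mem_zigzagEnds hbc (𝟙 _) (cochainAugmentMap Q.η_d Q'.η_d ψ g hψ)
  simp only [HomologicalComplex.id_f, Category.id_comp] at this
  exact this

theorem nonempty_extOfResolution_iso_extOfCoresolution {S T : ObjectProperty C}
    (hS : S ≤ HasProperResolution X) (hT : T ≤ HasProperCoresolution Y)
    (hX : ∀ M (hM : S M) R, Y R →
      (((homTo _).obj (op (properResolution X ⟨M, hS M hM⟩).augmented)).obj R).Acyclic)
    (hY : ∀ N (hN : T N) G, X G →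
      (((homFrom _).obj (op G)).obj (properCoresolution Y ⟨N, hT N hN⟩).augmented).Acyclic)
    (n : ℕ) :
    Nonempty ((ObjectProperty.ιOfLE hS).op ⋙ extOfResolution X n ⋙
        (Functor.whiskeringLeft _ _ _).obj T.ι ≅
      S.ι.op ⋙ extOfCoresolution Y n ⋙
        (Functor.whiskeringLeft _ _ _).obj (ObjectProperty.ιOfLE hT)) := by
  choose e he using fun (M : S.FullSubcategory) (N : T.FullSubcategory) =>
    exists_iso_balanceRel_iff (P := properResolution X ⟨M.obj, hS _ M.property⟩)
      (Q := properCoresolution Y ⟨N.obj, hT _ N.property⟩)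
      (fun q => hX _ M.property _ (ProperCoresolution.mem _ q))
      (fun p => hY _ N.property _ (ProperResolution.mem _ p)) n
  refine ⟨NatIso.ofComponents (fun M => NatIso.ofComponents (fun N => e M.unop N)
    fun {N N'} g => ?_) fun {M M'} f => ?_⟩
  · ext x
    exact (he _ _ _ _).1 (homologyMap_mem_balanceRel_right
      (ProperCoresolution.η_lift _ _ g.hom) ((he _ _ _ _).2 rfl))
  · ext N x
    exact (he _ _ _ _).1 (homologyMap_mem_balanceRel_left
      (ProperResolution.lift_π _ _ f.unop.hom) ((he _ _ _ _).2 rfl))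

end Balance

section FiniteDimension

theorem exists_forall_not_of_iSup_lt_top {p : ℕ → Prop}
    (h : ⨆ (n : ℕ) (_ : p n), (n : ℕ∞) < ⊤) : ∃ N, ∀ n, N ≤ n → ¬ p n := by
  obtain ⟨k, hk⟩ := ENat.ne_top_iff_exists.1 h.ne
  refine ⟨k + 1, fun n hn hp => ?_⟩
  have hnk : (n : ℕ∞) ≤ k := hk ▸ le_iSup₂ (f := fun (n : ℕ) (_ : p n) => (n : ℕ∞)) n hp
  rw [Nat.cast_le] at hnk
  lia

theorem ProperResolution.exactAt_homTo_augmented_iff {C : Type u} [Category.{v} C] [Abelian C]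
    {X : ObjectProperty C} {M W : C} {P : ProperResolution X M} {n : ℕ} :
    (((homTo _).obj (op P.augmented)).obj W).ExactAt (n + 2) ↔
      (((homTo _).obj (op P.complex)).obj W).ExactAt (n + 1) := by
  rw [exactAt_homTo_iff (i := n + 3) (k := n + 1) (by simp) (by simp),
    exactAt_homTo_iff (i := n + 2) (k := n) (by simp) (by simp)]
  rfl

theorem ProperCoresolution.exactAt_homFrom_augmented_iff {C : Type u} [Category.{v} C] [Abelian C]
    {X : ObjectProperty C} {N W : C} {Q : ProperCoresolution X N} {n : ℕ} :
    (((homFrom _).obj (op W)).obj Q.augmented).ExactAt (n + 2) ↔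
      (((homFrom _).obj (op W)).obj Q.complex).ExactAt (n + 1) := by
  rw [exactAt_homFrom_iff (i := n + 1) (k := n + 3) (by simp) (by simp),
    exactAt_homFrom_iff (i := n) (k := n + 2) (by simp) (by simp)]
  rfl

variable {A : Type u} [Ring A]

theorem exists_exactAt_homTo_augmented {M : (GPResolvable A).FullSubcategory} (hM : gpDim M < ⊤) :
    ∃ N, ∀ (W : ModuleCat.{u} A) n, N ≤ n →
      (((homTo _).obj (op (properResolution _ M).augmented)).obj W).ExactAt n := by
  obtain ⟨N, hN⟩ := exists_forall_not_of_iSup_lt_top hM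
  refine ⟨N + 2, fun W n hn => ?_⟩
  obtain ⟨n, rfl⟩ := Nat.exists_eq_add_of_le' (show 2 ≤ n by lia)
  rw [ProperResolution.exactAt_homTo_augmented_iff, HomologicalComplex.exactAt_iff_isZero_homology]
  exact not_exists_not.1 (hN (n + 1) (by lia)) W

theorem exists_exactAt_homFrom_augmented {N : (GIResolvable A).FullSubcategory}
    (hN : giDim N < ⊤) :
    ∃ k, ∀ (W : ModuleCat.{u} A) n, k ≤ n →
      (((homFrom _).obj (op W)).obj (properCoresolution _ N).augmented).ExactAt n := by
  obtain ⟨k, hk⟩ := exists_forall_not_of_iSup_lt_top hN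
  refine ⟨k + 2, fun W n hn => ?_⟩
  obtain ⟨n, rfl⟩ := Nat.exists_eq_add_of_le' (show 2 ≤ n by lia)
  rw [ProperCoresolution.exactAt_homFrom_augmented_iff,
    HomologicalComplex.exactAt_iff_isZero_homology]
  exact not_exists_not.1 (hk (n + 1) (by lia)) (op W)

theorem homTo_augmented_acyclic {M : (GPResolvable A).FullSubcategory} (hM : gpDim M < ⊤)
    {R : ModuleCat.{u} A} (hR : GorensteinInjective A R) :
    (((homTo _).obj (op (properResolution _ M).augmented)).obj R).Acyclic := by
  obtain ⟨N, hN⟩ := exists_exactAt_homTo_augmented hM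
  let P := properResolution _ M
  exact homTo_acyclic_of_eventually_exactAt P.acyclic
    (fun n => gorensteinProjective_iff.1 (P.mem n))
    (fun G hG => P.proper G (gorensteinProjective_iff.2 hG)) hN
    (gorensteinInjective_iff.1 hR).isInjectiveForFiniteProjectiveDimension_unop

theorem homFrom_augmented_acyclic {N : (GIResolvable A).FullSubcategory} (hN : giDim N < ⊤)
    {G : ModuleCat.{u} A} (hG : GorensteinProjective A G) :
    (((homFrom _).obj (op G)).obj (properCoresolution _ N).augmented).Acyclic := by
  obtain ⟨k, hk⟩ := exists_exactAt_homFrom_augmented hN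
  let Q := properCoresolution _ N
  exact homFrom_acyclic_of_eventually_exactAt Q.acyclic
    (fun n => gorensteinInjective_iff.1 (Q.mem n))
    (fun R hR => Q.proper R (gorensteinInjective_iff.2 hR)) hk
    (gorensteinProjective_iff.1 hG).isInjectiveForFiniteProjectiveDimension_op

end FiniteDimension

end GorensteinHom

theorem mainTheorem9_general (A : Type u) [Ring A] (n : ℕ) :
    Nonempty (GorensteinHom.extGPFinite A n ≅ GorensteinHom.extGIFinite A n) :=
  GorensteinHom.nonempty_extOfResolution_iso_extOfCoresolution _ _
    (fun _ hM _ hR => GorensteinHom.homTo_augmented_acyclic hM.2 hR)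
    (fun _ hN _ hG => GorensteinHom.homFrom_augmented_acyclic hN.2 hG) n

theorem mainTheorem9 (R : Type v) (A : Type u) [CommRing R] [IsArtinianRing R] [Ring A]
    [Algebra R A] [Module.Finite R A] (n : ℕ) :
    Nonempty (GorensteinHom.extGPFinite A n ≅ GorensteinHom.extGIFinite A n) :=
  mainTheorem9_general A n
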